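/- Let $(R,\mathfrak m)$ be a one-dimensional Noetherian local domain with residue field $k$ and field of quotients $Q$, whose integral closure $\overline R$ in $Q$ is a discrete valuation ring (with valuation $v$ and uniformizer $X$) and a finitely generated $R$-module, and assume $R\neq\overline R$. For $R$-submodules $\mathfrak a,\mathfrak b$ of $Q$ put $\mathfrak a:\mathfrak b=\{x\in Q\mid x\mathfrak b\subseteq\mathfrak a\}$ and $\mathfrak a^{-1}=R:\mathfrak a$. Let $v(R)=\{v(x)\mid x\in R,\ x\ne 0\}=\{s_0=0<s_1<s_2<\cdots\}$, let $C=R:\overline R=X^N\overline R$, and let $r+l\ge 1$ be the index with $s_{r+l}=N$ (where $s_r$ is the least $c$ such that every integer $\geq c$ lies in $v(R)$, and $l=N-s_r$). For $i\ge 0$ put $\mathfrak a_i=\{x\in R\mid v(x)\ge s_i\}$ and $n_i=\dim_k(\mathfrak a_i/\mathfrak a_{i+1})$. The type sequence of $R$ is ${\rm t.s.}(R)=(t_1,\dots,t_{r+l})$ with $t_i=\ell_R(\mathfrak a_i^{-1}/\mathfrak a_{i-1}^{-1})$. Let $t(R)=\ell_R(\mathfrak m^{-1}/R)$ be the Cohen–Macaulay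 type of $R$. The ring $R$ is called Gorenstein if it has finite injective dimension as a module over itself, almost Gorenstein if $\ell_R(\overline R/R)=\ell_R(R/C)+t(R)-1$, and Kunz if it is almost Gorenstein with $t(R)=2$. Then: 1. $R$ is Gorenstein if and only if ${\rm t.s.}(R)=(1,n_1,\dots,n_{r+l-1})$. 2. $R$ is Kunz if and only if ${\rm t.s.}(R)=(2,n_1,\dots,n_{r+l-1})$. -/

import Mathlib

open IsLocalRing CategoryTheory

noncomputable section

namespace TypeSeq

/-- The length `ℓ_R(F/E)` of the quotient of two `R`-submodules `E ⊆ F` of `Q`. -/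
def relLength (R Q : Type*) [CommRing R] [Field Q] [Algebra R Q] (F E : Submodule R Q) : ℕ∞ :=
  Module.length R (↥F ⧸ E.submoduleOf F)

/-- The inverse `𝔞⁻¹ = R : 𝔞 = {x ∈ Q | x𝔞 ⊆ R}` of an ideal `𝔞` of `R`, inside `Q`. -/
def idealInv (R Q : Type*) [CommRing R] [Field Q] [Algebra R Q] (a : Ideal R) : Submodule R Q :=
  (1 : Submodule R Q) / IsLocalization.coeSubmodule Q a

/-- The integral closure of `R` in `Q`, as an `R`-submodule of `Q`. -/
def intClosure (R Q : Type*) [CommRing R] [Field Q] [Algebra R Q] : Submodule R Q :=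
  Subalgebra.toSubmodule (integralClosure R Q)

/-- The conductor `C = R : R̄ = {x ∈ Q | x R̄ ⊆ R}`. -/
def conductorIdeal (R Q : Type*) [CommRing R] [Field Q] [Algebra R Q] : Submodule R Q :=
  (1 : Submodule R Q) / intClosure R Q

/-- The Cohen–Macaulay type `t(R) = ℓ_R(𝔪⁻¹/R)`. -/
def cmType (R Q : Type*) [CommRing R] [IsLocalRing R] [Field Q] [Algebra R Q] : ℕ∞ :=
  relLength R Q (idealInv R Q (maximalIdeal R)) 1

/-- `R` is almost Gorenstein: `ℓ_R(R̄/R) = ℓ_R(R/C) + t(R) - 1`. -/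
def IsAlmostGorenstein (R Q : Type*) [CommRing R] [IsLocalRing R] [Field Q] [Algebra R Q] : Prop :=
  relLength R Q (intClosure R Q) 1 + 1 = relLength R Q 1 (conductorIdeal R Q) + cmType R Q

/-- `R` is Kunz: almost Gorenstein of Cohen–Macaulay type `2`. -/
def IsKunz (R Q : Type*) [CommRing R] [IsLocalRing R] [Field Q] [Algebra R Q] : Prop :=
  IsAlmostGorenstein R Q ∧ cmType R Q = 2

/-- A Noetherian local ring is Gorenstein if it has finite injective dimension over itself. -/
def IsGorenstein (R : Type*) [CommRing R] [IsLocalRing R] : Prop :=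
  IsNoetherianRing R ∧ ∃ d : ℕ, HasInjectiveDimensionLE (ModuleCat.of R R) d

section Valuation

variable (R Q : Type*) [CommRing R] [Field Q] [Algebra R Q]
  [IsDiscreteValuationRing (integralClosure R Q)]

/-- The valuation `v` of the DVR `R̄`, on elements of `R`. -/
def val (x : R) : ℕ∞ :=
  IsDiscreteValuationRing.addVal (integralClosure R Q) (algebraMap R (integralClosure R Q) x)

/-- The semigroup of values `v(R) = {v(x) | x ∈ R, x ≠ 0}`. -/
def values : Set ℕ := {n | ∃ x : R, x ≠ 0 ∧ val R Q x = n}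

/-- The increasing enumeration `s₀ < s₁ < s₂ < ⋯` of `v(R)`. -/
def s (i : ℕ) : ℕ := Nat.nth (fun n => n ∈ values R Q) i

/-- The `R`-submodule `X ^ n R̄` of `Q`, with `X` a uniformizer of the DVR `R̄`. -/
def powClosure (n : ℕ) : Submodule R Q :=
  ((maximalIdeal (integralClosure R Q) ^ n).restrictScalars R).map
    (integralClosure R Q).val.toLinearMap

/-- The natural number `N` with `R : R̄ = X ^ N R̄`. -/
def conductorExp : ℕ := sInf {n : ℕ | conductorIdeal R Q = powClosure R Q n}

/-- The length `r + l` of the type sequence, that is the index with `s_{r+l} = N`. -/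
def seqLength : ℕ := sInf {i : ℕ | s R Q i = conductorExp R Q}

/-- The ideal `𝔞ᵢ = {x ∈ R | v(x) ≥ sᵢ}` of `R`. -/
def a (i : ℕ) : Ideal R where
  carrier := {x | (s R Q i : ℕ∞) ≤ val R Q x}
  zero_mem' := by simp [val]
  add_mem' := by
    intro x y hx hy
    simp only [Set.mem_ofPred_eq, val, map_add] at *
    exact AddValuation.map_le_add _ hx hy
  smul_mem' := by
    intro c x hx
    simp only [Set.mem_ofPred_eq, val, smul_eq_mul, map_mul, AddValuation.map_mul] at *
    exact hx.trans le_add_self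

/-- The `i`-th entry `tᵢ(R) = ℓ_R(𝔞ᵢ⁻¹/𝔞ᵢ₋₁⁻¹)` of the type sequence, for `i ≥ 1`. -/
def t (i : ℕ) : ℕ∞ :=
  relLength R Q (idealInv R Q (a R Q i)) (idealInv R Q (a R Q (i - 1)))

/-- The type sequence `(t₁(R), …, t_{r+l}(R))`. -/
def typeSequence : List ℕ∞ :=
  (List.range (seqLength R Q)).map fun j => t R Q (j + 1)

variable [IsLocalRing R] [IsDomain R] [IsFractionRing R Q]

/-- `𝔪 𝔞ᵢ ⊆ 𝔞ᵢ₊₁`, so that `𝔞ᵢ/𝔞ᵢ₊₁` is a vector space over the residue field of `R`. -/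
theorem isTorsionBySet_quotient (i : ℕ) :
    Module.IsTorsionBySet R (↥(a R Q i) ⧸ (a R Q (i + 1)).submoduleOf (a R Q i))
      (maximalIdeal R : Set R) := by
  have hinj : Function.Injective (algebraMap R (integralClosure R Q)) := by
    intro x y h
    apply IsFractionRing.injective R Q
    simpa using congrArg (algebraMap (integralClosure R Q) Q) h
  have key : ∀ x ∈ maximalIdeal R, ∀ y ∈ a R Q i, x * y ∈ a R Q (i + 1) := by
    intro x hx y hy
    by_cases h0 : x * y = 0
    · rw [h0]; exact zero_mem _
    have hle : ((s R Q i : ℕ∞)) ≤ val R Q y := hy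
    have hx1 : 1 ≤ val R Q x := by
      rw [Order.one_le_iff_ne_zero]
      intro hv
      have : FaithfulSMul R (integralClosure R Q) :=
        (faithfulSMul_iff_algebraMap_injective _ _).2 hinj
      rw [val, ← IsDiscreteValuationRing.addVal_one (R := integralClosure R Q)] at hv
      have hu : IsUnit (algebraMap R (integralClosure R Q) x) :=
        isUnit_of_dvd_one (IsDiscreteValuationRing.addVal_le_iff_dvd.1 hv.le)
      exact hx (isUnit_of_map_unit (algebraMap R (integralClosure R Q)) x hu)
    have hmul : val R Q (x * y) = val R Q x + val R Q y := by
      simp [val]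
    have hne : val R Q (x * y) ≠ ⊤ := by
      rw [val, Ne, IsDiscreteValuationRing.addVal_eq_top_iff, map_eq_zero_iff _ hinj]
      exact h0
    obtain ⟨m, hm⟩ := ENat.ne_top_iff_exists.1 hne
    have hmem : m ∈ values R Q := ⟨x * y, h0, hm.symm⟩
    have hlt : s R Q i < m := by
      have h1 : ((s R Q i + 1 : ℕ) : ℕ∞) ≤ m := by
        rw [hm, hmul, add_comm, Nat.cast_add, Nat.cast_one]
        gcongr
      exact_mod_cast h1
    have hge : s R Q (i + 1) ≤ m := by
      by_contra hcon
      exact absurd (Nat.le_nth_of_lt_nth_succ (not_le.1 hcon) hmem) (not_le.2 hlt)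
    change (s R Q (i + 1) : ℕ∞) ≤ val R Q (x * y)
    rw [← hm]
    exact_mod_cast hge
  rintro q ⟨x, hx⟩
  obtain ⟨y, rfl⟩ := Submodule.Quotient.mk_surjective _ q
  change x • Submodule.Quotient.mk y = _
  rw [← Submodule.Quotient.mk_smul, Submodule.Quotient.mk_eq_zero]
  exact key x hx y y.2

/-- `nᵢ = dim_k(𝔞ᵢ/𝔞ᵢ₊₁)`, where `k` is the residue field of `R`. -/
def n (i : ℕ) : ℕ :=
  letI : Module (ResidueField R) (↥(a R Q i) ⧸ (a R Q (i + 1)).submoduleOf (a R Q i)) :=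
    (isTorsionBySet_quotient R Q i).module
  Module.finrank (ResidueField R) (↥(a R Q i) ⧸ (a R Q (i + 1)).submoduleOf (a R Q i))

end Valuation

end TypeSeq

end

/-! The chain `R = 𝔞₀ ⊇ 𝔞₁ ⊇ ⋯ ⊇ 𝔞_{r+l} = C` has steps of length `nᵢ`. Taking inverses gives a
chain from `R` up to `C⁻¹ = R̄` with steps of length `tᵢ₊₁`. Hence `∑ nᵢ = ℓ(R/C)` (`sum_n`) and `∑
tᵢ₊₁ = ℓ(R̄/R)` (`sum_t`), with `n₀ = 1` and `t₁ = t(R)`.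

The key inequality is `nᵢ ≤ tᵢ₊₁` (`n_le_t`). It comes from pairing `X ^ j R̄` with `𝔞ᵢ` into `X ^
(N - 1) R̄`, which is not contained in `R`, and reading off leading coefficients. Almost Gorenstein
says that the two sums agree once `t₁` and `n₀` are dropped, so it holds exactly when `tᵢ₊₁ = nᵢ`
for every `i ≥ 1` (`isAlmostGorenstein_iff`). Together with `t₁ = 2` this is the Kunz statement.

For the Gorenstein statement, a divisible module of finite injective dimension over a
one-dimensional Noetherian local domain is injective, so `R` is Gorenstein iff `Q/R` is injective
(`isGorenstein_iff_baer`). Counting lengths of inverses shows that this happens iff `t(R) = 1`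
(`baer_iff_cmType_eq_one`). In that case `E ↦ R : E` preserves lengths between nonzero ideals, which
forces `tᵢ₊₁ = nᵢ` for all `i`. -/

namespace TypeSeq

/-! ### Relative lengths of submodules of `Q`, and filtrations with simple steps. -/

section Length

variable {R Q : Type*} [CommRing R] [Field Q] [Algebra R Q]

theorem mk_submoduleOf_eq_zero {E F : Submodule R Q} (x : F) :
    (Submodule.Quotient.mk x : F ⧸ E.submoduleOf F) = 0 ↔ (x : Q) ∈ E :=
  Submodule.Quotient.mk_eq_zero _

theorem relLength_self (E : Submodule R Q) : relLength R Q E E = 0 := by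
  unfold relLength
  rw [Submodule.submoduleOf_self, Module.length_eq_zero_iff]
  infer_instance

theorem relLength_eq_length_range {M : Type*} [AddCommGroup M] [Module R M] {E F : Submodule R Q}
    (f : F →ₗ[R] M) (h : ∀ x : F, f x = 0 ↔ (x : Q) ∈ E) :
    relLength R Q F E = Module.length R (LinearMap.range f) := by
  have hk : E.submoduleOf F = LinearMap.ker f := by
    ext x
    exact (h x).symm
  exact ((Submodule.quotEquivOfEq _ _ hk).trans f.quotKerEquivRange).length_eq

theorem relLength_eq_length_of_surjective {M : Type*} [AddCommGroup M] [Module R M]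
    {E F : Submodule R Q} (f : F →ₗ[R] M) (h : ∀ x : F, f x = 0 ↔ (x : Q) ∈ E)
    (hf : Function.Surjective f) : relLength R Q F E = Module.length R M := by
  rw [relLength_eq_length_range f h, LinearMap.range_eq_top.2 hf, Module.length_top]

theorem relLength_add {E F G : Submodule R Q} (hEF : E ≤ F) (hFG : F ≤ G) :
    relLength R Q G E = relLength R Q F E + relLength R Q G F := by
  let f : (F ⧸ E.submoduleOf F) →ₗ[R] (G ⧸ E.submoduleOf G) :=
    Submodule.mapQ _ _ (Submodule.inclusion hFG) fun x hx => hx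
  let g : (G ⧸ E.submoduleOf G) →ₗ[R] (G ⧸ F.submoduleOf G) :=
    Submodule.mapQ _ _ LinearMap.id fun x hx => hEF hx
  refine Module.length_eq_add_of_exact f g ?_ ?_ ?_
  · rw [injective_iff_map_eq_zero]
    intro x hx
    obtain ⟨x, rfl⟩ := Submodule.Quotient.mk_surjective _ x
    exact (mk_submoduleOf_eq_zero x).2
      ((mk_submoduleOf_eq_zero (E := E) (Submodule.inclusion hFG x)).1 hx)
  · intro x
    obtain ⟨x, rfl⟩ := Submodule.Quotient.mk_surjective _ x
    exact ⟨Submodule.Quotient.mk x, rfl⟩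
  · intro x
    obtain ⟨x, rfl⟩ := Submodule.Quotient.mk_surjective _ x
    constructor
    · intro hx
      have hx' : (x : Q) ∈ F := (mk_submoduleOf_eq_zero x).1 hx
      exact ⟨Submodule.Quotient.mk ⟨x, hx'⟩, rfl⟩
    · rintro ⟨y, hy⟩
      obtain ⟨y, rfl⟩ := Submodule.Quotient.mk_surjective _ y
      rw [← hy]
      exact (Submodule.Quotient.mk_eq_zero _).2 y.2

theorem relLength_eq_of_mul_mem {c : Q} (hc : c ≠ 0) {E F E' F' : Submodule R Q}
    (hE : ∀ x, x ∈ E ↔ c * x ∈ E') (hF : ∀ x, x ∈ F ↔ c * x ∈ F') :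
    relLength R Q F E = relLength R Q F' E' := by
  let f : F →ₗ[R] (F' ⧸ E'.submoduleOf F') :=
    (E'.submoduleOf F').mkQ ∘ₗ
      ((LinearMap.mulLeft R c).restrict (p := F) (q := F') fun x hx => (hF x).1 hx)
  refine relLength_eq_length_of_surjective f (fun x => ?_) fun x => ?_
  · exact (Submodule.Quotient.mk_eq_zero _).trans (hE x).symm
  · obtain ⟨⟨x, hx⟩, rfl⟩ := Submodule.Quotient.mk_surjective _ x
    have hcx : c * (c⁻¹ * x) = x := by field_simp
    refine ⟨⟨c⁻¹ * x, (hF _).2 (by rwa [hcx])⟩, ?_⟩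
    exact congrArg Submodule.Quotient.mk (Subtype.ext hcx)

theorem length_eq_one_of_generator [IsLocalRing R] {M : Type*} [AddCommGroup M] [Module R M]
    {a : M} (ha : a ≠ 0) (hm : ∀ r ∈ maximalIdeal R, r • a = 0) (hs : ∀ x : M, ∃ r : R, r • a = x) :
    Module.length R M = 1 := by
  have hk : LinearMap.ker (LinearMap.toSpanSingleton R M a) = maximalIdeal R := by
    refine ((maximalIdeal.isMaximal R).eq_of_le (fun h => ha ?_) fun r hr => hm r hr).symm
    simpa using (Ideal.eq_top_iff_one _).1 h
  rw [Module.length_eq_one_iff,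
    ← (LinearMap.quotKerEquivOfSurjective (LinearMap.toSpanSingleton R M a) hs).isSimpleModule_iff,
    hk, isSimpleModule_iff_isCoatom]
  exact (maximalIdeal.isMaximal R).out

variable [IsLocalRing R]

theorem mem_maximalIdeal_of_smul_mem {M : Type*} [AddCommGroup M] [Module R M] {E : Submodule R M}
    {a : M} (ha : a ∉ E) {r : R} (hr : r • a ∈ E) : r ∈ maximalIdeal R := by
  rw [mem_maximalIdeal, mem_nonunits_iff]
  rintro hu
  exact ha ((Submodule.smul_mem_iff_of_isUnit E hu).1 hr)

theorem relLength_sup_span {E : Submodule R Q} {a : Q} (ha : a ∉ E)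
    (hm : ∀ r ∈ maximalIdeal R, r • a ∈ E) : relLength R Q (E ⊔ R ∙ a) E = 1 := by
  have haF : a ∈ E ⊔ R ∙ a := Submodule.mem_sup_right (Submodule.mem_span_singleton_self a)
  refine length_eq_one_of_generator
    (a := (Submodule.Quotient.mk ⟨a, haF⟩ : _ ⧸ E.submoduleOf _)) ?_ ?_ ?_
  · exact fun h => ha ((mk_submoduleOf_eq_zero _).1 h)
  · exact fun r hr => (Submodule.Quotient.mk_eq_zero _).2 (hm r hr)
  · intro x
    obtain ⟨⟨x, hx⟩, rfl⟩ := Submodule.Quotient.mk_surjective _ x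
    obtain ⟨e, he, y, hy, rfl⟩ := Submodule.mem_sup.1 hx
    obtain ⟨r, rfl⟩ := Submodule.mem_span_singleton.1 hy
    refine ⟨r, (Submodule.Quotient.eq _).2 ?_⟩
    change r • a - (e + r • a) ∈ E
    simpa using he

/-- If `a ∉ E`, the annihilator of `a` modulo `E` is a proper ideal, hence lies in `𝔪` and kills
`w`. So `a ↦ w` is well defined on `(E + Ra)/E`. -/
theorem exists_hom_of_simple_step {N M : Type*} [AddCommGroup M] [Module R M]
    [AddCommGroup N] [Module R N] {E : Submodule R N} {a : N} (ha : a ∉ E) {w : M}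
    (hw : ∀ r ∈ maximalIdeal R, r • w = 0) :
    ∃ g : ↥(E ⊔ R ∙ a) →ₗ[R] M, (∀ x : ↥(E ⊔ R ∙ a), (x : N) ∈ E → g x = 0) ∧
      ∀ x : ↥(E ⊔ R ∙ a), (x : N) = a → g x = w := by
  let p := LinearPMap.mkSpanSingleton' (σ := RingHom.id R) (E.mkQ a) w fun c hc =>
    hw c (mem_maximalIdeal_of_smul_mem ha ((Submodule.Quotient.mk_eq_zero E).1 hc))
  have hp : ∀ x ∈ E ⊔ R ∙ a, E.mkQ x ∈ p.domain := by
    intro x hx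
    obtain ⟨e, he, y, hy, rfl⟩ := Submodule.mem_sup.1 hx
    obtain ⟨r, rfl⟩ := Submodule.mem_span_singleton.1 hy
    refine Submodule.mem_span_singleton.2 ⟨r, ?_⟩
    rw [map_add, map_smul]
    simp [he]
  refine ⟨p.toFun ∘ₗ E.mkQ.restrict (p := E ⊔ R ∙ a) (q := p.domain) hp, ?_, ?_⟩
  · rintro ⟨x, hx⟩ hxE
    have : (E.mkQ.restrict (p := E ⊔ R ∙ a) (q := p.domain) hp) ⟨x, hx⟩ = 0 :=
      Subtype.ext ((Submodule.Quotient.mk_eq_zero _).2 hxE)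
    rw [LinearMap.comp_apply, this, map_zero]
  · rintro ⟨x, hx⟩ hxa
    have hxa' : x = a := hxa
    subst hxa'
    exact LinearPMap.mkSpanSingleton'_apply_self _ _ _ _

variable [IsDomain R]

theorem eq_maximalIdeal_of_isPrime_of_ne_bot (hdim : ringKrullDim R = 1) {p : Ideal R}
    (hp : p.IsPrime) (h0 : p ≠ ⊥) : p = maximalIdeal R := by
  have : Ring.KrullDimLE 1 R := Ring.krullDimLE_iff.2 hdim.le
  exact eq_maximalIdeal (hp.isMaximal_of_ne_bot h0)

variable [IsNoetherianRing R] [IsFractionRing R Q]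

/-- An associated prime of `F/E` is nonzero, because `F/E` is torsion when `E ≠ 0`; in dimension one
it must then be `𝔪`. -/
theorem exists_simple_step (hdim : ringKrullDim R = 1) {E F : Submodule R Q} (hE : E ≠ ⊥)
    (hEF : E < F) : ∃ a ∈ F, a ∉ E ∧ ∀ r ∈ maximalIdeal R, r • a ∈ E := by
  obtain ⟨x, hxF, hxE⟩ := SetLike.exists_of_lt hEF
  obtain ⟨P, hP, -⟩ := exists_le_isAssociatedPrime_of_isNoetherianRing R
    (Submodule.Quotient.mk ⟨x, hxF⟩ : F ⧸ E.submoduleOf F)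
    fun h => hxE ((mk_submoduleOf_eq_zero _).1 h)
  rw [isAssociatedPrime_iff] at hP
  obtain ⟨hprime, y, rfl⟩ := hP
  obtain ⟨⟨a, haF⟩, rfl⟩ := Submodule.Quotient.mk_surjective _ y
  have hmem : ∀ r : R, r ∈ (⊥ : Submodule R (F ⧸ E.submoduleOf F)).colon
      {Submodule.Quotient.mk ⟨a, haF⟩} ↔ r • a ∈ E := by
    intro r
    rw [Submodule.mem_colon_singleton, Submodule.mem_bot, ← Submodule.Quotient.mk_smul,
      Submodule.Quotient.mk_eq_zero]
    rfl
  have hne : (⊥ : Submodule R (F ⧸ E.submoduleOf F)).colon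
      {Submodule.Quotient.mk ⟨a, haF⟩} ≠ ⊥ := by
    -- Writing `a / z = b / c` with `z ∈ E` gives `c • a = b • z ∈ E`, so the denominator `c` is a
    -- nonzero annihilator.
    obtain ⟨z, hzE, hz0⟩ := Submodule.exists_mem_ne_zero_of_ne_bot hE
    obtain ⟨b, c, hc, hbc⟩ := IsFractionRing.div_surjective (A := R) (a / z)
    rw [Submodule.ne_bot_iff]
    refine ⟨c, (hmem c).2 ?_, nonZeroDivisors.ne_zero hc⟩
    have hc0 : algebraMap R Q c ≠ 0 := IsFractionRing.to_map_ne_zero_of_mem_nonZeroDivisors hc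
    have : c • a = b • z := by
      rw [Algebra.smul_def, Algebra.smul_def]
      field_simp at hbc
      rw [← hbc]
    rw [this]
    exact E.smul_mem b hzE
  have hpm := eq_maximalIdeal_of_isPrime_of_ne_bot hdim hprime hne
  refine ⟨a, haF, fun haE => hprime.ne_top ?_, fun r hr => (hmem r).1 (hpm ▸ hr)⟩
  rw [Ideal.eq_top_iff_one, hmem, one_smul]
  exact haE

/-- Noetherian induction descending from `F` to `E` through quotients isomorphic to the residue
field. It stands in for a composition series of `F/E`. -/
theorem induction_on_simple_step (hdim : ringKrullDim R = 1) {F : Submodule R Q} [IsNoetherian R F]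
    {P : Submodule R Q → Prop} (top : P F)
    (step : ∀ E, E ≠ ⊥ → ∀ a, a ∉ E → (∀ r ∈ maximalIdeal R, r • a ∈ E) → E ⊔ R ∙ a ≤ F →
      P (E ⊔ R ∙ a) → P E) {E : Submodule R Q} (hE : E ≠ ⊥) (hEF : E ≤ F) : P E := by
  induction h : E.submoduleOf F using WellFoundedGT.induction generalizing E with
  | ind S ih =>
    subst h
    rcases hEF.eq_or_lt with rfl | hlt
    · exact top
    obtain ⟨a, haF, haE, hm⟩ := exists_simple_step hdim hE hlt
    have hle : E ⊔ R ∙ a ≤ F := sup_le hEF ((Submodule.span_singleton_le_iff_mem _ _).2 haF)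
    refine step E hE a haE hm hle (ih _ ?_ ?_ hle rfl)
    · refine lt_of_le_of_ne (fun x hx => Submodule.mem_sup_left (S := E) hx) fun heq => haE ?_
      have : (⟨a, haF⟩ : F) ∈ (E ⊔ R ∙ a).submoduleOf F :=
        Submodule.mem_sup_right (S := E) (Submodule.mem_span_singleton_self a)
      rw [← heq] at this
      exact this
    · exact ne_bot_of_le_ne_bot hE le_sup_left

theorem relLength_ne_top (hdim : ringKrullDim R = 1) {E F : Submodule R Q} [IsNoetherian R F]
    (hE : E ≠ ⊥) (hEF : E ≤ F) : relLength R Q F E ≠ ⊤ := by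
  refine induction_on_simple_step hdim (P := fun E => relLength R Q F E ≠ ⊤) ?_ ?_ hE hEF
  · simp [relLength_self]
  · intro E hE a ha hm hle ih
    rw [relLength_add le_sup_left hle, relLength_sup_span ha hm]
    exact WithTop.add_ne_top.2 ⟨ENat.one_ne_top, ih⟩

end Length

/-! ### The duality `E ↦ R : E`, and injectivity of `Q/R` versus type one. -/

section Colon

variable {R Q : Type*} [CommRing R] [Field Q] [Algebra R Q]

theorem mem_coeSubmodule {I : Ideal R} {x : R} [IsDomain R] [IsFractionRing R Q] :
    algebraMap R Q x ∈ IsLocalization.coeSubmodule Q I ↔ x ∈ I := by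
  rw [IsLocalization.mem_coeSubmodule]
  exact ⟨fun ⟨y, hy, h⟩ => IsFractionRing.injective R Q h ▸ hy, fun h => ⟨x, h, rfl⟩⟩

theorem one_div_anti {E F : Submodule R Q} (h : E ≤ F) :
    (1 : Submodule R Q) / F ≤ 1 / E := fun _ hx y hy => hx y (h hy)

theorem one_div_one : (1 : Submodule R Q) / 1 = 1 := by
  refine le_antisymm (fun x hx => ?_) fun x hx y hy => ?_
  · simpa using hx 1 (Submodule.one_le.1 le_rfl)
  · rw [← one_mul (1 : Submodule R Q)]
    exact Submodule.mul_mem_mul hx hy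

/-- Multiplication by `y` carries `y⁻¹R/R` onto `R/yR`. -/
theorem relLength_one_div_span {y : Q} (hy : y ≠ 0) :
    relLength R Q (1 / (R ∙ y)) 1 = relLength R Q 1 (R ∙ y) := by
  refine relLength_eq_of_mul_mem hy (fun x => ?_) fun x => ?_
  · rw [Submodule.mem_span_singleton, Submodule.mem_one]
    refine exists_congr fun r => ?_
    rw [Algebra.smul_def, mul_comm y x]
    exact ⟨fun h => by rw [h], fun h => mul_right_cancel₀ hy h⟩
  · constructor
    · intro h
      rw [mul_comm]
      exact h y (Submodule.mem_span_singleton_self y)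
    · intro h z hz
      obtain ⟨r, rfl⟩ := Submodule.mem_span_singleton.1 hz
      rw [mul_smul_comm, mul_comm]
      exact Submodule.smul_mem _ r h

theorem mem_idealInv_iff {I : Ideal R} {x : Q} :
    x ∈ idealInv R Q I ↔ ∀ r ∈ I, r • x ∈ (1 : Submodule R Q) := by
  constructor
  · intro h r hr
    rw [Algebra.smul_def, mul_comm]
    exact h _ ⟨r, hr, rfl⟩
  · rintro h _ ⟨r, hr, rfl⟩
    have := h r hr
    rwa [Algebra.smul_def, mul_comm] at this

/-- An extension of `g` to all of `R` is determined by its value at `1`, and `q` is a lift of that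
value. -/
theorem exists_mul_of_baer (hB : Module.Baer R (Q ⧸ (1 : Submodule R Q))) {F : Submodule R Q}
    (hF : F ≤ 1) (g : F →ₗ[R] (Q ⧸ (1 : Submodule R Q))) :
    ∃ q : Q, ∀ x : F, g x = Submodule.Quotient.mk (q * x) := by
  let I : Ideal R := F.comap (Algebra.linearMap R Q)
  obtain ⟨g', hg'⟩ := hB I (g ∘ₗ (Algebra.linearMap R Q).restrict (p := I) (q := F) fun x hx => hx)
  obtain ⟨q, hq⟩ := Submodule.Quotient.mk_surjective _ (g' 1)
  refine ⟨q, fun ⟨x, hx⟩ => ?_⟩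
  obtain ⟨r, rfl⟩ := Submodule.mem_one.1 (hF hx)
  rw [mul_comm, ← Algebra.smul_def, Submodule.Quotient.mk_smul, hq, ← map_smul, smul_eq_mul,
    mul_one, hg' r hx]
  rfl

variable [IsLocalRing R]

theorem exists_mem_maximalIdeal_ne_zero (hdim : ringKrullDim R = 1) :
    ∃ x ∈ maximalIdeal R, x ≠ 0 := by
  refine Submodule.exists_mem_ne_zero_of_ne_bot fun h => ?_
  rw [ringKrullDim_eq_zero_of_isField (isField_iff_maximalIdeal_eq.2 h)] at hdim
  exact zero_ne_one hdim

/-- The map is `x ↦ xa` modulo `R`. It embeds the quotient `(R : E)/(R : (E + Ra))` into `𝔪⁻¹/R`, so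
each simple step costs at most `t(R)` after dualizing. -/
theorem exists_colonMap (E : Submodule R Q) {a : Q} (hm : ∀ r ∈ maximalIdeal R, r • a ∈ E) :
    ∃ f : ↥((1 : Submodule R Q) / E) →ₗ[R]
        (idealInv R Q (maximalIdeal R) ⧸
          (1 : Submodule R Q).submoduleOf (idealInv R Q (maximalIdeal R))),
      (∀ x, f x = 0 ↔ (x : Q) ∈ (1 : Submodule R Q) / (E ⊔ R ∙ a)) ∧
      ∀ x : ↥((1 : Submodule R Q) / E), ∀ w : idealInv R Q (maximalIdeal R),
        (x : Q) * a - w ∈ (1 : Submodule R Q) → f x = Submodule.Quotient.mk w := by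
  have hmem : ∀ x ∈ (1 : Submodule R Q) / E,
      LinearMap.mulRight R a x ∈ idealInv R Q (maximalIdeal R) := by
    intro x hx
    rw [mem_idealInv_iff]
    intro r hr
    rw [LinearMap.mulRight_apply, ← mul_smul_comm]
    exact hx _ (hm r hr)
  refine ⟨Submodule.mkQ _ ∘ₗ (LinearMap.mulRight R a).restrict hmem, fun x => ?_, fun x w h => ?_⟩
  · refine (mk_submoduleOf_eq_zero _).trans ⟨fun h y hy => ?_, fun h => ?_⟩
    · obtain ⟨e, he, z, hz, rfl⟩ := Submodule.mem_sup.1 hy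
      obtain ⟨r, rfl⟩ := Submodule.mem_span_singleton.1 hz
      rw [mul_add, mul_smul_comm]
      exact add_mem (x.2 e he) (Submodule.smul_mem _ r h)
    · exact h a (Submodule.mem_sup_right (Submodule.mem_span_singleton_self a))
  · exact (Submodule.Quotient.eq _).2 h

theorem relLength_one_div_step_le (E : Submodule R Q) {a : Q}
    (hm : ∀ r ∈ maximalIdeal R, r • a ∈ E) :
    relLength R Q (1 / E) (1 / (E ⊔ R ∙ a)) ≤ cmType R Q := by
  obtain ⟨f, hf, -⟩ := exists_colonMap E hm
  rw [relLength_eq_length_range f hf]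
  exact Module.length_le_of_injective _ (Submodule.subtype_injective _)

/-- Injectivity of `Q/R` makes the map of `exists_colonMap` surjective: for `w ∈ 𝔪⁻¹`, the
homomorphism killing `E` and sending `a` to `w` is multiplication by some `q`, and then `q ∈ R : E`
maps to `w`. -/
theorem relLength_one_div_step_eq (hB : Module.Baer R (Q ⧸ (1 : Submodule R Q)))
    {E : Submodule R Q} {a : Q} (ha : a ∉ E) (hm : ∀ r ∈ maximalIdeal R, r • a ∈ E)
    (hle : E ⊔ R ∙ a ≤ 1) :
    relLength R Q (1 / E) (1 / (E ⊔ R ∙ a)) = cmType R Q := by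
  obtain ⟨f, hf, hfw⟩ := exists_colonMap E hm
  refine relLength_eq_length_of_surjective f hf fun w => ?_
  obtain ⟨⟨w, hw⟩, rfl⟩ := Submodule.Quotient.mk_surjective _ w
  obtain ⟨g, hgE, hga⟩ := exists_hom_of_simple_step (M := Q ⧸ (1 : Submodule R Q)) ha
    (w := Submodule.Quotient.mk w) fun r hr => by
      rw [← Submodule.Quotient.mk_smul, Submodule.Quotient.mk_eq_zero]
      exact mem_idealInv_iff.1 hw r hr
  obtain ⟨q, hq⟩ := exists_mul_of_baer hB hle g
  have hqE : q ∈ (1 : Submodule R Q) / E := fun x hx => by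
    rw [← Submodule.Quotient.mk_eq_zero, ← hq ⟨x, Submodule.mem_sup_left hx⟩, hgE _ hx]
  refine ⟨⟨q, hqE⟩, hfw _ _ ?_⟩
  rw [← Submodule.Quotient.mk_eq_zero, Submodule.Quotient.mk_sub, sub_eq_zero,
    ← hga ⟨a, Submodule.mem_sup_right (Submodule.mem_span_singleton_self a)⟩ rfl, hq]

variable [IsDomain R] [IsNoetherianRing R] [IsFractionRing R Q]

theorem relLength_one_div_le (hdim : ringKrullDim R = 1) {E F : Submodule R Q} [IsNoetherian R F]
    (hE : E ≠ ⊥) (hEF : E ≤ F) :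
    relLength R Q (1 / E) (1 / F) ≤ cmType R Q * relLength R Q F E := by
  refine induction_on_simple_step hdim
    (P := fun E => relLength R Q (1 / E) (1 / F) ≤ cmType R Q * relLength R Q F E) ?_ ?_ hE hEF
  · simp [relLength_self]
  · intro E hE a ha hm hle ih
    rw [relLength_add (one_div_anti hle) (one_div_anti le_sup_left),
      relLength_add le_sup_left hle, relLength_sup_span ha hm, mul_add, mul_one, add_comm]
    exact add_le_add (relLength_one_div_step_le E hm) ih

instance : IsNoetherian R (1 : Submodule R Q) := by
  rw [Submodule.one_eq_range]
  infer_instance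

theorem relLength_one_div_eq_of_baer (hdim : ringKrullDim R = 1)
    (hB : Module.Baer R (Q ⧸ (1 : Submodule R Q))) {E F : Submodule R Q} (hE : E ≠ ⊥)
    (hEF : E ≤ F) (hF : F ≤ 1) :
    relLength R Q (1 / E) (1 / F) = cmType R Q * relLength R Q F E := by
  have : IsNoetherian R F := isNoetherian_of_le hF
  refine induction_on_simple_step hdim
    (P := fun E => relLength R Q (1 / E) (1 / F) = cmType R Q * relLength R Q F E) ?_ ?_ hE hEF
  · simp [relLength_self]
  · intro E hE a ha hm hle ih
    rw [relLength_add (one_div_anti hle) (one_div_anti le_sup_left),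
      relLength_add le_sup_left hle, relLength_sup_span ha hm, mul_add, mul_one, add_comm,
      relLength_one_div_step_eq hB ha hm (hle.trans hF), ih]

/-- For nonzero `x ∈ 𝔪`, the length of `x⁻¹R/R` is `t(R) · ℓ(R/xR)` by duality and `ℓ(R/xR)` by
scaling. This number is finite and nonzero, so it cancels. -/
theorem cmType_eq_one_of_baer (hdim : ringKrullDim R = 1)
    (hB : Module.Baer R (Q ⧸ (1 : Submodule R Q))) : cmType R Q = 1 := by
  obtain ⟨x, hxm, hx0⟩ := exists_mem_maximalIdeal_ne_zero hdim
  have hx : algebraMap R Q x ≠ 0 := by simpa using hx0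
  have hle : (R ∙ algebraMap R Q x) ≤ 1 :=
    (Submodule.span_singleton_le_iff_mem _ _).2 (Submodule.algebraMap_mem x)
  have hbot : (R ∙ algebraMap R Q x) ≠ ⊥ := by simpa using hx
  have h := relLength_one_div_eq_of_baer hdim hB hbot hle le_rfl
  rw [one_div_one, relLength_one_div_span hx] at h
  have htop := relLength_ne_top hdim hbot hle
  have hne : relLength R Q 1 (R ∙ algebraMap R Q x) ≠ 0 := by
    intro h0
    rw [relLength, Module.length_eq_zero_iff] at h0
    have h1 := (mk_submoduleOf_eq_zero (E := R ∙ algebraMap R Q x)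
      (⟨1, Submodule.one_le.1 le_rfl⟩ : (1 : Submodule R Q))).1 (Subsingleton.elim _ _)
    obtain ⟨r, hr⟩ := Submodule.mem_span_singleton.1 h1
    rw [Algebra.smul_def, ← map_mul] at hr
    have : r * x = 1 := IsFractionRing.injective R Q (by simpa using hr)
    exact hxm (IsUnit.of_mul_eq_one_right r this)
  generalize relLength R Q 1 (R ∙ algebraMap R Q x) = n at *
  generalize cmType R Q = c at *
  lift n to ℕ using htop
  cases c with
  | top => exact (ENat.natCast_ne_top n (h.trans (ENat.top_mul hne))).elim
  | coe c =>
    norm_cast at *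
    nlinarith [Nat.pos_of_ne_zero hne]

theorem exists_simple_step_ideal (hdim : ringKrullDim R = 1) {I J : Ideal R} (hI : I ≠ ⊥)
    (hIJ : I < J) : ∃ a ∈ J, a ∉ I ∧ ∀ r ∈ maximalIdeal R, r * a ∈ I := by
  have hE : IsLocalization.coeSubmodule (FractionRing R) I ≠ ⊥ := by
    obtain ⟨x, hx, hx0⟩ := Submodule.exists_mem_ne_zero_of_ne_bot hI
    rw [Submodule.ne_bot_iff]
    exact ⟨algebraMap R _ x, mem_coeSubmodule.2 hx, by simpa using hx0⟩
  obtain ⟨_, ⟨a, haJ, rfl⟩, haI, hm⟩ := exists_simple_step hdim hE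
    (IsLocalization.coeSubmodule_strictMono le_rfl hIJ)
  refine ⟨a, haJ, fun h => haI (mem_coeSubmodule.2 h), fun r hr =>
    (mem_coeSubmodule (Q := FractionRing R)).1 ?_⟩
  rw [map_mul, ← Algebra.smul_def]
  exact hm r hr

/-- Take `0 ≠ y ∈ E`. In type one each simple step between `Ry` and `R` contributes at most one to
`ℓ(y⁻¹R/R)`, yet the total equals `ℓ(R/Ry)`. A step contributing nothing would leave the total too
small. -/
theorem one_div_ne_of_cmType_eq_one (hdim : ringKrullDim R = 1) (hτ : cmType R Q = 1)
    {E : Submodule R Q} (hE : E ≠ ⊥) {a : Q} (ha : a ∉ E)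
    (hm : ∀ r ∈ maximalIdeal R, r • a ∈ E) (hle : E ⊔ R ∙ a ≤ 1) :
    ¬ (1 : Submodule R Q) / E ≤ 1 / (E ⊔ R ∙ a) := by
  intro hcon
  obtain ⟨y, hyE, hy⟩ := Submodule.exists_mem_ne_zero_of_ne_bot hE
  have hyE' : (R ∙ y) ≤ E := (Submodule.span_singleton_le_iff_mem _ _).2 hyE
  have hE1 : E ≤ 1 := le_sup_left.trans hle
  have : IsNoetherian R E := isNoetherian_of_le hE1
  have hbot : (R ∙ y) ≠ ⊥ := by simpa using hy
  have h1 : relLength R Q (1 / (R ∙ y)) 1 = relLength R Q (1 / (E ⊔ R ∙ a)) 1 +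
      relLength R Q (1 / (R ∙ y)) (1 / E) := by
    rw [← le_antisymm hcon (one_div_anti le_sup_left)]
    exact relLength_add (Submodule.one_le_one_div.2 hE1) (one_div_anti hyE')
  have h2 := relLength_one_div_le hdim hbot hyE'
  have h3 := relLength_one_div_le hdim (ne_bot_of_le_ne_bot hE le_sup_left) hle
  rw [one_div_one, hτ, one_mul] at h3
  rw [hτ, one_mul] at h2
  have h4 : relLength R Q 1 (R ∙ y) = relLength R Q E (R ∙ y) +
      (1 + relLength R Q 1 (E ⊔ R ∙ a)) := by
    rw [relLength_add hyE' hE1, relLength_add (G := 1) (le_sup_left) hle, relLength_sup_span ha hm]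
  have htop := relLength_ne_top hdim hbot (hyE'.trans hE1)
  rw [relLength_one_div_span hy] at h1
  have h5 := h1.le.trans (add_le_add h3 h2)
  rw [h4] at h5 htop
  obtain ⟨h6, h7⟩ := WithTop.add_ne_top.1 htop
  obtain ⟨h7, h8⟩ := WithTop.add_ne_top.1 h7
  generalize relLength R Q E (R ∙ y) = m at *
  generalize relLength R Q 1 (E ⊔ R ∙ a) = n at *
  lift m to ℕ using h6
  lift n to ℕ using h8
  norm_cast at h5
  omega

/-- Among the nonzero ideals inside `J` on which `f` is multiplication by an element of `Q`, take a
maximal one, `I`. If `I ≠ J`, the error `f(a) - aq` at a simple step lies in `𝔪⁻¹/R`, which is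
simple. Some `u ∈ R : I` therefore corrects it without changing anything on `I`. -/
theorem baer_of_cmType_eq_one (hdim : ringKrullDim R = 1) (hτ : cmType R Q = 1) :
    Module.Baer R (Q ⧸ (1 : Submodule R Q)) := by
  intro J f
  by_cases hJ : J = ⊥
  · subst hJ
    refine ⟨0, fun x hx => ?_⟩
    have : (⟨x, hx⟩ : (⊥ : Ideal R)) = 0 := Subsingleton.elim _ _
    rw [this, map_zero, LinearMap.zero_apply]
  obtain ⟨j, hjJ, hj0⟩ := Submodule.exists_mem_ne_zero_of_ne_bot hJ
  obtain ⟨q, hq⟩ := Submodule.Quotient.mk_surjective _ (f ⟨j, hjJ⟩)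
  obtain ⟨b, c, hc, hbc⟩ := IsFractionRing.div_surjective (A := R) q
  have hc0 : algebraMap R Q c ≠ 0 := IsFractionRing.to_map_ne_zero_of_mem_nonZeroDivisors hc
  -- Clearing the denominator of a lift of `f j` gives a nonzero element killed by `f`. It starts
  -- the search at a nonzero ideal, as simple steps require.
  have hy : f (c • ⟨j, hjJ⟩) = 0 := by
    rw [map_smul, ← hq, ← Submodule.Quotient.mk_smul, Submodule.Quotient.mk_eq_zero, ← hbc,
      Algebra.smul_def, mul_div_cancel₀ _ hc0]
    exact Submodule.algebraMap_mem b
  have hy0 : c * j ≠ 0 := mul_ne_zero (nonZeroDivisors.ne_zero hc) hj0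
  let S : Set (Ideal R) := {I | c * j ∈ I ∧ I ≤ J ∧
    ∃ q : Q, ∀ x (hx : x ∈ J), x ∈ I → f ⟨x, hx⟩ = x • Submodule.Quotient.mk q}
  have hS : S.Nonempty := by
    refine ⟨Ideal.span {c * j}, Ideal.mem_span_singleton_self _,
      (Ideal.span_singleton_le_iff_mem _).2 (J.mul_mem_left c hjJ), 0, fun x hx hxI => ?_⟩
    obtain ⟨r, rfl⟩ := Ideal.mem_span_singleton'.1 hxI
    have : (⟨r * (c * j), hx⟩ : J) = r • (c • ⟨j, hjJ⟩) := rfl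
    rw [this, map_smul, hy, Submodule.Quotient.mk_zero, smul_zero, smul_zero]
  obtain ⟨I, ⟨hyI, hIJ, q, hq⟩, hmax⟩ := set_has_maximal_iff_noetherian.2 ‹IsNoetherianRing R› S hS
  rcases hIJ.eq_or_lt with rfl | hlt
  · exact ⟨LinearMap.toSpanSingleton R _ (Submodule.Quotient.mk q), fun x hx => (hq x hx hx).symm⟩
  exfalso
  let E := IsLocalization.coeSubmodule Q I
  have hE : E ≠ ⊥ := by
    rw [Submodule.ne_bot_iff]
    exact ⟨algebraMap R Q (c * j), mem_coeSubmodule.2 hyI, by simpa using hy0⟩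
  have hI0 : I ≠ ⊥ := (Submodule.ne_bot_iff _).2 ⟨_, hyI, hy0⟩
  obtain ⟨a, haJ, haI, hmI⟩ := exists_simple_step_ideal hdim hI0 hlt
  have haI' : algebraMap R Q a ∉ E := fun h => haI (mem_coeSubmodule.1 h)
  have hm : ∀ r ∈ maximalIdeal R, r • algebraMap R Q a ∈ E := fun r hr => by
    rw [Algebra.smul_def, ← map_mul]
    exact mem_coeSubmodule.2 (hmI r hr)
  have hle : E ⊔ R ∙ (algebraMap R Q a) ≤ 1 := by
    refine sup_le ?_ ((Submodule.span_singleton_le_iff_mem _ _).2 (Submodule.algebraMap_mem a))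
    rintro _ ⟨x, hx, rfl⟩
    exact Submodule.algebraMap_mem x
  obtain ⟨w, hw⟩ := Submodule.Quotient.mk_surjective _ (f ⟨a, haJ⟩ - a • Submodule.Quotient.mk q)
  have hwm : w ∈ idealInv R Q (maximalIdeal R) := by
    rw [mem_idealInv_iff]
    intro r hr
    rw [← Submodule.Quotient.mk_eq_zero, Submodule.Quotient.mk_smul, hw, smul_sub, ← map_smul,
      ← mul_smul, sub_eq_zero]
    exact hq _ _ (hmI r hr)
  obtain ⟨g, hg0, hgw⟩ := exists_colonMap E hm
  obtain ⟨p, hpE, hpa⟩ := SetLike.not_le_iff_exists.1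
    (one_div_ne_of_cmType_eq_one hdim hτ hE haI' hm hle)
  have hsimple := Module.length_eq_one_iff.1 hτ
  -- `g` is nonzero because `p` lies in `R : E` but not in `R : (E + Ra)`; a nonzero map to a simple
  -- module is onto.
  have hrange : LinearMap.range g = ⊤ := by
    refine (eq_bot_or_eq_top _).resolve_left fun h => hpa ((hg0 ⟨p, hpE⟩).1 ?_)
    rw [LinearMap.range_eq_bot.1 h, LinearMap.zero_apply]
  obtain ⟨⟨u, huE⟩, hu⟩ := LinearMap.range_eq_top.1 hrange (Submodule.Quotient.mk ⟨w, hwm⟩)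
  have hua : u * algebraMap R Q a ∈ idealInv R Q (maximalIdeal R) := by
    rw [mem_idealInv_iff]
    intro r hr
    rw [← mul_smul_comm]
    exact huE _ (hm r hr)
  rw [hgw ⟨u, huE⟩ ⟨_, hua⟩ (by simp)] at hu
  have hu' : u * algebraMap R Q a - w ∈ (1 : Submodule R Q) :=
    (Submodule.Quotient.eq ((1 : Submodule R Q).submoduleOf _)).1 hu
  rw [← Submodule.Quotient.mk_eq_zero, Submodule.Quotient.mk_sub, sub_eq_zero, hw, mul_comm,
    ← Algebra.smul_def, Submodule.Quotient.mk_smul] at hu'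
  refine hmax (I ⊔ Ideal.span {a}) ⟨Ideal.mem_sup_left hyI,
    sup_le hIJ ((Ideal.span_singleton_le_iff_mem _).2 haJ), q + u, ?_⟩ ?_
  · intro x hx hxI
    obtain ⟨i, hi, z, hz, rfl⟩ := Submodule.mem_sup.1 hxI
    obtain ⟨r, rfl⟩ := Ideal.mem_span_singleton'.1 hz
    have hsplit : (⟨i + r * a, hx⟩ : J) = ⟨i, hIJ hi⟩ + r • ⟨a, haJ⟩ := rfl
    have hiu : i • (Submodule.Quotient.mk u : Q ⧸ (1 : Submodule R Q)) = 0 := by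
      rw [← Submodule.Quotient.mk_smul, Submodule.Quotient.mk_eq_zero, Algebra.smul_def, mul_comm]
      exact huE _ (mem_coeSubmodule.2 hi)
    rw [hsplit, map_add, map_smul, hq i _ hi, ← sub_add_cancel (f ⟨a, haJ⟩)
      (a • Submodule.Quotient.mk q), ← hu', Submodule.Quotient.mk_add, smul_add, smul_add, add_smul,
      add_smul, hiu,
      mul_smul, mul_smul]
    abel
  · refine lt_of_le_of_ne le_sup_left fun h => haI ?_
    rw [h]
    exact Ideal.mem_sup_right (Ideal.mem_span_singleton_self a)

theorem baer_iff_cmType_eq_one (hdim : ringKrullDim R = 1) :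
    Module.Baer R (Q ⧸ (1 : Submodule R Q)) ↔ cmType R Q = 1 :=
  ⟨cmType_eq_one_of_baer hdim, baer_of_cmType_eq_one hdim⟩

end Colon

/-! ### Baer's criterion in dimension one. -/

section Injective

theorem exists_smul_eq_of_baer {R M : Type*} [CommRing R] [IsDomain R] [AddCommGroup M]
    [Module R M] (hM : Module.Baer R M) {x : R} (hx : x ≠ 0) (m : M) : ∃ m', x • m' = m := by
  let e := LinearEquiv.toSpanNonzeroSingleton R R x hx
  obtain ⟨g, hg⟩ := hM (R ∙ x) (LinearMap.toSpanSingleton R M m ∘ₗ e.symm.toLinearMap)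
  refine ⟨g 1, ?_⟩
  have hxm : x ∈ R ∙ x := Submodule.mem_span_singleton_self x
  have hex : e.symm ⟨x, hxm⟩ = 1 := by
    rw [LinearEquiv.symm_apply_eq]
    exact Subtype.ext (by simp [e])
  rw [← map_smul, smul_eq_mul, mul_one, hg x hxm, LinearMap.comp_apply, LinearEquiv.coe_coe, hex,
    LinearMap.toSpanSingleton_apply, one_smul]

theorem baer_fractionField (R Q : Type*) [CommRing R] [IsDomain R] [Field Q] [Algebra R Q]
    [IsFractionRing R Q] : Module.Baer R Q := by
  intro J f
  by_cases hJ : J = ⊥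
  · subst hJ
    refine ⟨0, fun x hx => ?_⟩
    have : (⟨x, hx⟩ : (⊥ : Ideal R)) = 0 := Subsingleton.elim _ _
    rw [this, map_zero, LinearMap.zero_apply]
  obtain ⟨j, hjJ, hj0⟩ := Submodule.exists_mem_ne_zero_of_ne_bot hJ
  have hj : algebraMap R Q j ≠ 0 := by simpa using hj0
  refine ⟨LinearMap.toSpanSingleton R Q (f ⟨j, hjJ⟩ / algebraMap R Q j), fun x hx => ?_⟩
  have h : x • f ⟨j, hjJ⟩ = j • f ⟨x, hx⟩ := by
    rw [← map_smul, ← map_smul]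
    exact congrArg f (Subtype.ext (mul_comm _ _))
  rw [Algebra.smul_def, Algebra.smul_def] at h
  rw [LinearMap.toSpanSingleton_apply, Algebra.smul_def, ← mul_div_assoc, h,
    mul_div_cancel_left₀ _ hj]

theorem exists_extend_sup_span {R M : Type*} [CommRing R] [IsDomain R] [AddCommGroup M]
    [Module R M] {J : Ideal R} (f : J →ₗ[R] M) {a : R} (ha : a ≠ 0) {e : M}
    (h : ∀ r (hr : r * a ∈ J), f ⟨r * a, hr⟩ = r • e) :
    ∃ g : ↥(J ⊔ Ideal.span {a}) →ₗ[R] M, ∀ x (hx : x ∈ J),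
      g ⟨x, Ideal.mem_sup_left hx⟩ = f ⟨x, hx⟩ := by
  let p : R →ₗ.[R] M := LinearPMap.mk J f
  let q : R →ₗ.[R] M := LinearPMap.mkSpanSingleton' (σ := RingHom.id R) a e fun c hc => by
    have hc0 : c = 0 := (mul_eq_zero.1 hc).resolve_right ha
    simp [hc0]
  have hpq : ∀ (x : p.domain) (y : q.domain), (x : R) = y → p x = q y := by
    rintro ⟨x, hx⟩ ⟨y, hy⟩ hxy
    obtain ⟨r, rfl⟩ := Submodule.mem_span_singleton.1 hy
    have hxr : x = r * a := hxy
    subst hxr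
    exact (h r hx).trans
      (LinearPMap.mkSpanSingleton'_apply (σ := RingHom.id R) a e _ r hy).symm
  exact ⟨(p.sup q hpq).toFun, fun x hx =>
    ((p.left_le_sup q hpq).2 (x := ⟨x, hx⟩) (y := ⟨x, Ideal.mem_sup_left hx⟩) rfl).symm⟩

variable {R : Type*} [CommRing R] [IsDomain R] [IsLocalRing R] [IsNoetherianRing R]

/-- Only `Ext¹(k, M) = 0` has to be tested: extending `f` from `J` across a simple step `a` amounts
to writing `r ↦ f(ra)` on `𝔪` as `r ↦ r • e`. The zero ideal is separate because a simple step needs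
a nonzero start. -/
theorem baer_of_extends_maximalIdeal (hdim : ringKrullDim R = 1) {M : Type*} [AddCommGroup M]
    [Module R M]
    (hM : ∀ f : maximalIdeal R →ₗ[R] M, ∃ e : M, ∀ r (hr : r ∈ maximalIdeal R),
      f ⟨r, hr⟩ = r • e) : Module.Baer R M := by
  intro J
  induction J using WellFoundedGT.induction with
  | ind J ih =>
    intro f
    by_cases hJ : J = ⊥
    · subst hJ
      refine ⟨0, fun x hx => ?_⟩
      have : (⟨x, hx⟩ : (⊥ : Ideal R)) = 0 := Subsingleton.elim _ _
      rw [this, map_zero, LinearMap.zero_apply]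
    rcases eq_or_ne J ⊤ with rfl | htop
    · exact ⟨f ∘ₗ Submodule.topEquiv.symm.toLinearMap, fun x hx => rfl⟩
    obtain ⟨a, -, haJ, hm⟩ := exists_simple_step_ideal hdim hJ htop.lt_top
    have ha0 : a ≠ 0 := fun h => haJ (h ▸ J.zero_mem)
    obtain ⟨e, he⟩ := hM (f ∘ₗ (LinearMap.mulRight R a).restrict (p := maximalIdeal R) (q := J) hm)
    obtain ⟨g, hg⟩ := exists_extend_sup_span f ha0 (e := e) fun r hr =>
      he r (mem_maximalIdeal_of_smul_mem haJ hr)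
    obtain ⟨g', hg'⟩ := ih (J ⊔ Ideal.span {a}) (lt_of_le_of_ne le_sup_left fun h => haJ <| by
      rw [h]
      exact Ideal.mem_sup_right (Ideal.mem_span_singleton_self a)) g
    exact ⟨g', fun x hx => by rw [hg' x (Ideal.mem_sup_left hx), hg x hx]⟩

/-- Regard `M` as a submodule of `I`. It suffices to lift every element `u` of `I` whose class in
`I/M` is killed by `𝔪` to an element of `I` killed by `𝔪`. Choose `z ∉ (x)` with `𝔪z ⊆ (x)`.
Injectivity of `I/M` gives `w` with `xw ∈ M` and `zw ≡ u` modulo `M`; divisibility of `M` gives `xw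
= xe₂` with `e₂ ∈ M`. Then `z(w - e₂)` is the required lift. -/
theorem baer_of_divisible_of_baer_quotient (hdim : ringKrullDim R = 1) {M I : Type*}
    [AddCommGroup M] [Module R M] [AddCommGroup I] [Module R I]
    (hM : ∀ x : R, x ≠ 0 → ∀ m : M, ∃ m', x • m' = m) (i : M →ₗ[R] I)
    (hi : Function.Injective i) (hI : Module.Baer R I)
    (hI' : Module.Baer R (I ⧸ LinearMap.range i)) : Module.Baer R M := by
  refine baer_of_extends_maximalIdeal hdim fun f => ?_
  obtain ⟨x, hxm, hx0⟩ := exists_mem_maximalIdeal_ne_zero hdim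
  have hlt : Ideal.span {x} < ⊤ := ((Ideal.span_singleton_le_iff_mem _).2 hxm).trans_lt
    (Ideal.IsMaximal.ne_top inferInstance).lt_top
  obtain ⟨z, -, hzx, hmz⟩ := exists_simple_step_ideal hdim (by simpa using hx0) hlt
  obtain ⟨F, hF⟩ := hI _ (i ∘ₗ f)
  let u := F 1
  have hFu : ∀ r, F r = r • u := fun r => by rw [← map_smul, smul_eq_mul, mul_one]
  obtain ⟨g, hg0, hgz⟩ := exists_hom_of_simple_step (M := I ⧸ LinearMap.range i) hzx
    (w := Submodule.Quotient.mk u) fun r hr => by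
      rw [← Submodule.Quotient.mk_smul, Submodule.Quotient.mk_eq_zero, ← hFu, hF r hr]
      exact ⟨_, rfl⟩
  obtain ⟨G, hG⟩ := hI' _ g
  obtain ⟨w, hw⟩ := Submodule.Quotient.mk_surjective _ (G 1)
  have hGw : ∀ r, G r = Submodule.Quotient.mk (r • w) := fun r => by
    rw [Submodule.Quotient.mk_smul, hw, ← map_smul, smul_eq_mul, mul_one]
  have hxx : x ∈ Ideal.span {x} := Ideal.mem_span_singleton_self x
  have hxw : x • w ∈ LinearMap.range i := by
    rw [← Submodule.Quotient.mk_eq_zero, ← hGw, hG x (Submodule.mem_sup_left hxx)]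
    exact hg0 _ hxx
  have hzw : z • w - u ∈ LinearMap.range i := by
    rw [← Submodule.Quotient.mk_eq_zero, Submodule.Quotient.mk_sub, ← hGw, sub_eq_zero,
      hG z (Submodule.mem_sup_right (Submodule.mem_span_singleton_self z))]
    exact hgz _ rfl
  obtain ⟨e₁, he₁⟩ := hxw
  obtain ⟨e₂, rfl⟩ := hM x hx0 e₁
  obtain ⟨e₃, he₃⟩ := hzw
  -- In `I` this element is `u - z(w - e₂)`, and `𝔪` kills the second term, so it acts on `𝔪` as `u`
  -- does.
  refine ⟨z • e₂ - e₃, fun r hr => hi ?_⟩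
  have h1 : i (f ⟨r, hr⟩) = r • u := (hF r hr).symm.trans (hFu r)
  obtain ⟨c, hc⟩ := Ideal.mem_span_singleton'.1 (hmz r hr)
  have h2 : (r * z) • w = (r * z) • i e₂ := by
    rw [← hc, mul_smul, mul_smul, ← he₁, map_smul]
  rw [h1, map_smul, map_sub, map_smul, he₃, smul_sub, smul_sub, ← mul_smul, ← mul_smul, h2]
  abel

end Injective

/-! ### Finite injective dimension of `R` and injectivity of `Q/R`. -/

section InjectiveDimension

universe u

variable {R : Type u} [CommRing R]

theorem baer_iff_injective_of {M : Type u} [AddCommGroup M] [Module R M] :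
    Module.Baer R M ↔ CategoryTheory.Injective (ModuleCat.of R M) :=
  Module.Baer.iff_injective.trans (Module.injective_iff_injective_object R M)

theorem shortExact_mkQ {M N : Type u} [AddCommGroup M] [Module R M] [AddCommGroup N] [Module R N]
    (i : M →ₗ[R] N) (hi : Function.Injective i) :
    (ShortComplex.mk (ModuleCat.ofHom i) (ModuleCat.ofHom (LinearMap.range i).mkQ)
      (by ext x; simp)).ShortExact where
  exact := by
    rw [ShortComplex.moduleCat_exact_iff]
    intro x hx
    exact (Submodule.Quotient.mk_eq_zero _).1 hx
  mono_f := (ModuleCat.mono_iff_injective _).2 hi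
  epi_g := (ModuleCat.epi_iff_surjective _).2 (Submodule.mkQ_surjective _)

variable [IsDomain R] [IsLocalRing R] [IsNoetherianRing R]

/-- Embed `M` in an injective `I`. The cokernel is again divisible and has smaller injective
dimension, so by induction it is injective, and `baer_of_divisible_of_baer_quotient` descends this
to `M`. -/
theorem baer_of_divisible_of_hasInjectiveDimensionLT (hdim : ringKrullDim R = 1) (n : ℕ)
    (M : Type u) [AddCommGroup M] [Module R M]
    (hM : ∀ x : R, x ≠ 0 → ∀ m : M, ∃ m', x • m' = m)
    (h : HasInjectiveDimensionLT (ModuleCat.of R M) (n + 1)) : Module.Baer R M := by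
  induction n generalizing M with
  | zero =>
    rw [baer_iff_injective_of]
    infer_instance
  | succ n ih =>
    let I := Injective.under (ModuleCat.of R M)
    let i : M →ₗ[R] I := (Injective.ι (ModuleCat.of R M)).hom
    have hi : Function.Injective i := (ModuleCat.mono_iff_injective _).1 inferInstance
    have hinj : CategoryTheory.Injective (ModuleCat.of R I) :=
      inferInstanceAs (CategoryTheory.Injective (Injective.under (ModuleCat.of R M)))
    have hI : Module.Baer R I := baer_iff_injective_of.2 hinj
    refine baer_of_divisible_of_baer_quotient hdim hM i hi hI (ih _ ?_ ?_)
    · intro x hx m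
      obtain ⟨m, rfl⟩ := Submodule.Quotient.mk_surjective _ m
      obtain ⟨m', rfl⟩ := exists_smul_eq_of_baer hI hx m
      exact ⟨Submodule.Quotient.mk m', rfl⟩
    · have hlt : HasInjectiveDimensionLT (ModuleCat.of R I) 1 := inferInstance
      exact (shortExact_mkQ i hi).hasInjectiveDimensionLT_X₃ (n + 1)
        (hasInjectiveDimensionLT_of_ge _ 1 _ (by omega)) h

theorem isGorenstein_iff_baer (Q : Type*) [Field Q] [Algebra R Q] [IsFractionRing R Q]
    (hdim : ringKrullDim R = 1) :
    IsGorenstein R ↔ Module.Baer R (Q ⧸ (1 : Submodule R Q)) := by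
  let K := FractionRing R
  let i : R →ₗ[R] K := Algebra.linearMap R K
  have hi : Function.Injective i := IsFractionRing.injective R K
  let e : (K ⧸ LinearMap.range i) ≃ₗ[R] (Q ⧸ (1 : Submodule R Q)) :=
    Submodule.Quotient.equiv _ _ (FractionRing.algEquiv R Q).toLinearEquiv <| by
      ext x
      simp only [Submodule.mem_map, LinearMap.mem_range, Submodule.mem_one]
      constructor
      · rintro ⟨_, ⟨r, rfl⟩, rfl⟩
        exact ⟨r, ((FractionRing.algEquiv R Q).commutes r).symm⟩
      · rintro ⟨r, rfl⟩
        exact ⟨_, ⟨r, rfl⟩, (FractionRing.algEquiv R Q).commutes r⟩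
  rw [← Module.Baer.congr e]
  have hK : Module.Baer R K := baer_fractionField R K
  have hKinj : CategoryTheory.Injective (ModuleCat.of R K) := baer_iff_injective_of.1 hK
  have hK1 : HasInjectiveDimensionLT (ModuleCat.of R K) 1 := inferInstance
  constructor
  · rintro ⟨-, d, hd⟩
    refine baer_of_divisible_of_hasInjectiveDimensionLT hdim d _ ?_ ?_
    · intro x hx m
      obtain ⟨m, rfl⟩ := Submodule.Quotient.mk_surjective _ m
      obtain ⟨m', rfl⟩ := exists_smul_eq_of_baer hK hx m
      exact ⟨Submodule.Quotient.mk m', rfl⟩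
    · exact (shortExact_mkQ i hi).hasInjectiveDimensionLT_X₃ (d + 1)
        (hasInjectiveDimensionLT_of_ge _ 1 _ (by omega))
        (hasInjectiveDimensionLT_of_ge _ (d + 1) _ (by omega))
  · intro hB
    have : CategoryTheory.Injective (ModuleCat.of R (K ⧸ LinearMap.range i)) :=
      baer_iff_injective_of.1 hB
    have hB1 : HasInjectiveDimensionLT (ModuleCat.of R (K ⧸ LinearMap.range i)) 1 := inferInstance
    exact ⟨inferInstance, 1, (shortExact_mkQ i hi).hasInjectiveDimensionLT_X₁ 1 hB1
      (hasInjectiveDimensionLT_of_ge _ 1 _ (by omega))⟩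

end InjectiveDimension

/-! ### The value semigroup, the conductor and the ideals `𝔞ᵢ`. -/

section Values

variable {R Q : Type*} [CommRing R] [Field Q] [Algebra R Q]

theorem one_le_intClosure : (1 : Submodule R Q) ≤ intClosure R Q := by
  intro x hx
  obtain ⟨r, rfl⟩ := Submodule.mem_one.1 hx
  exact (integralClosure R Q).algebraMap_mem r

theorem conductorIdeal_le_one : conductorIdeal R Q ≤ 1 := fun x hx => by
  simpa using hx 1 (one_le_intClosure (Submodule.one_le.1 le_rfl))

theorem mul_mem_conductorIdeal {x y : Q} (hx : x ∈ conductorIdeal R Q)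
    (hy : y ∈ intClosure R Q) : x * y ∈ conductorIdeal R Q := fun z hz => by
  rw [mul_assoc]
  exact hx _ ((integralClosure R Q).mul_mem hy hz)

theorem conductorIdeal_ne_bot [IsDomain R] [IsFractionRing R Q]
    [Module.Finite R (integralClosure R Q)] :
    conductorIdeal R Q ≠ ⊥ := by
  have hfg : (intClosure R Q).FG := Module.Finite.iff_fg.1
    (inferInstanceAs (Module.Finite R (integralClosure R Q)))
  obtain ⟨c, hc, h⟩ := FractionalIdeal.isFractional_of_fg (S := nonZeroDivisors R) hfg
  refine (Submodule.ne_bot_iff _).2 ⟨algebraMap R Q c, fun y hy => ?_,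
    IsFractionRing.to_map_ne_zero_of_mem_nonZeroDivisors hc⟩
  rw [← Algebra.smul_def]
  exact Submodule.mem_one.2 (h y hy)

variable [IsDiscreteValuationRing (integralClosure R Q)]

open IsDiscreteValuationRing in
theorem mem_powClosure_iff {n : ℕ} {q : Q} : q ∈ powClosure R Q n ↔
    ∃ v : integralClosure R Q, (n : ℕ∞) ≤ addVal (integralClosure R Q) v ∧ (v : Q) = q := by
  obtain ⟨ϖ, hϖ⟩ := exists_irreducible (integralClosure R Q)
  have h : ∀ v : integralClosure R Q, v ∈ IsLocalRing.maximalIdeal (integralClosure R Q) ^ n ↔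
      (n : ℕ∞) ≤ addVal (integralClosure R Q) v := fun v => by
    rw [hϖ.maximalIdeal_eq, Ideal.span_singleton_pow, Ideal.mem_span_singleton,
      ← addVal_le_iff_dvd, hϖ.addVal_pow]
  exact exists_congr fun v => and_congr_left fun _ => h v

theorem coe_mem_powClosure_iff {n : ℕ} {v : integralClosure R Q} : (v : Q) ∈ powClosure R Q n ↔
    (n : ℕ∞) ≤ IsDiscreteValuationRing.addVal (integralClosure R Q) v := by
  rw [mem_powClosure_iff]
  exact ⟨fun ⟨w, hw, h⟩ => Subtype.ext h ▸ hw, fun h => ⟨v, h, rfl⟩⟩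

theorem algebraMap_mem_powClosure_iff {n : ℕ} {x : R} :
    algebraMap R Q x ∈ powClosure R Q n ↔ (n : ℕ∞) ≤ val R Q x :=
  coe_mem_powClosure_iff (v := algebraMap R (integralClosure R Q) x)

theorem powClosure_zero : powClosure R Q 0 = intClosure R Q := by
  ext q
  rw [mem_powClosure_iff]
  exact ⟨fun ⟨v, _, h⟩ => h ▸ v.2, fun h => ⟨⟨q, h⟩, zero_le, rfl⟩⟩

theorem powClosure_anti {m n : ℕ} (h : m ≤ n) : powClosure R Q n ≤ powClosure R Q m := by
  intro q hq
  obtain ⟨v, hv, rfl⟩ := mem_powClosure_iff.1 hq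
  exact coe_mem_powClosure_iff.2 (le_trans (by exact_mod_cast h) hv)

theorem powClosure_le_intClosure (n : ℕ) : powClosure R Q n ≤ intClosure R Q :=
  (powClosure_anti (Nat.zero_le n)).trans powClosure_zero.le

theorem mul_mem_powClosure {m n : ℕ} {x y : Q} (hx : x ∈ powClosure R Q m)
    (hy : y ∈ powClosure R Q n) : x * y ∈ powClosure R Q (m + n) := by
  obtain ⟨v, hv, rfl⟩ := mem_powClosure_iff.1 hx
  obtain ⟨w, hw, rfl⟩ := mem_powClosure_iff.1 hy
  refine mem_powClosure_iff.2 ⟨v * w, ?_, rfl⟩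
  rw [IsDiscreteValuationRing.addVal_mul, Nat.cast_add]
  exact add_le_add hv hw

theorem mul_mem_powClosure_of_mem_intClosure {n : ℕ} {x y : Q} (hx : x ∈ powClosure R Q n)
    (hy : y ∈ intClosure R Q) : x * y ∈ powClosure R Q n :=
  mul_mem_powClosure (n := 0) hx (powClosure_zero (R := R) (Q := Q) ▸ hy)

/-- The conductor is also an ideal of the discrete valuation ring `R̄`. -/
theorem exists_conductorIdeal_eq_powClosure (h : conductorIdeal R Q ≠ ⊥) :
    ∃ n, conductorIdeal R Q = powClosure R Q n := by
  let I : Ideal (integralClosure R Q) :=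
    { carrier := {v | (v : Q) ∈ conductorIdeal R Q}
      zero_mem' := (conductorIdeal R Q).zero_mem
      add_mem' := fun hx hy => (conductorIdeal R Q).add_mem hx hy
      smul_mem' := fun c x hx => by
        change (c : Q) * (x : Q) ∈ conductorIdeal R Q
        rw [mul_comm]
        exact mul_mem_conductorIdeal hx c.2 }
  have hmem : ∀ v : integralClosure R Q, v ∈ I ↔ (v : Q) ∈ conductorIdeal R Q := fun _ => Iff.rfl
  have hV : conductorIdeal R Q ≤ intClosure R Q := conductorIdeal_le_one.trans one_le_intClosure
  have hI : I ≠ ⊥ := by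
    obtain ⟨x, hx, hx0⟩ := Submodule.exists_mem_ne_zero_of_ne_bot h
    exact (Submodule.ne_bot_iff _).2 ⟨⟨x, hV hx⟩, hx, fun h0 => hx0 (congrArg Subtype.val h0)⟩
  obtain ⟨ϖ, hϖ⟩ := IsDiscreteValuationRing.exists_irreducible (integralClosure R Q)
  obtain ⟨n, hn⟩ := IsDiscreteValuationRing.ideal_eq_span_pow_irreducible hI hϖ
  refine ⟨n, ?_⟩
  ext q
  have key : ∀ v : integralClosure R Q, (v : Q) ∈ conductorIdeal R Q ↔
      (v : Q) ∈ powClosure R Q n := fun v => by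
    rw [← hmem, hn, Ideal.mem_span_singleton, ← IsDiscreteValuationRing.addVal_le_iff_dvd,
      hϖ.addVal_pow, coe_mem_powClosure_iff]
  exact ⟨fun hq => (key ⟨q, hV hq⟩).1 hq, fun hq => (key ⟨q, powClosure_le_intClosure n hq⟩).2 hq⟩

theorem mem_a_iff {i : ℕ} {x : R} : x ∈ a R Q i ↔ (s R Q i : ℕ∞) ≤ val R Q x := Iff.rfl

theorem coeSubmodule_a_le_powClosure (i : ℕ) :
    IsLocalization.coeSubmodule Q (a R Q i) ≤ powClosure R Q (s R Q i) := by
  rintro _ ⟨x, hx, rfl⟩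
  exact algebraMap_mem_powClosure_iff.2 hx

variable [IsDomain R]

theorem zero_mem_values : 0 ∈ values R Q := ⟨1, one_ne_zero, by simp [val]⟩

theorem s_zero : s R Q 0 = 0 := Nat.nth_zero_of_zero zero_mem_values

theorem a_zero : a R Q 0 = ⊤ := by
  rw [eq_top_iff]
  intro x _
  rw [mem_a_iff, s_zero]
  exact zero_le

variable [IsFractionRing R Q]

theorem val_ne_top {x : R} (hx : x ≠ 0) : val R Q x ≠ ⊤ := by
  rw [val, Ne, IsDiscreteValuationRing.addVal_eq_top_iff]
  intro h
  refine hx (IsFractionRing.injective R Q ?_)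
  simpa using congrArg (algebraMap (integralClosure R Q) Q) h

/-- There are no values strictly between consecutive elements of `v(R)`. -/
theorem s_succ_le_val {i : ℕ} {x : R} (h : ((s R Q i + 1 : ℕ) : ℕ∞) ≤ val R Q x) :
    (s R Q (i + 1) : ℕ∞) ≤ val R Q x := by
  rcases eq_or_ne x 0 with rfl | hx
  · simp [val]
  obtain ⟨m, hm⟩ := ENat.ne_top_iff_exists.1 (val_ne_top (Q := Q) hx)
  have hmem : m ∈ values R Q := ⟨x, hx, hm.symm⟩
  rw [← hm] at h ⊢
  by_contra hcon
  have h1 : s R Q i + 1 ≤ m := by exact_mod_cast h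
  have h2 : m < s R Q (i + 1) := by
    rw [not_le] at hcon
    exact_mod_cast hcon
  have h3 : m ≤ s R Q i := Nat.le_nth_of_lt_nth_succ h2 hmem
  omega

theorem relLength_coeSubmodule_a [IsLocalRing R] [IsNoetherianRing R] (i : ℕ) :
    relLength R Q (IsLocalization.coeSubmodule Q (a R Q i))
      (IsLocalization.coeSubmodule Q (a R Q (i + 1))) = n R Q i := by
  let _ : Module (ResidueField R) (↥(a R Q i) ⧸ (a R Q (i + 1)).submoduleOf (a R Q i)) :=
    (isTorsionBySet_quotient R Q i).module
  have : IsScalarTower R (ResidueField R)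
      (↥(a R Q i) ⧸ (a R Q (i + 1)).submoduleOf (a R Q i)) :=
    (isTorsionBySet_quotient R Q i).isScalarTower
  have : Module.Finite (ResidueField R) (↥(a R Q i) ⧸ (a R Q (i + 1)).submoduleOf (a R Q i)) :=
    Module.Finite.of_restrictScalars_finite R _ _
  have h1 : (n R Q i : ℕ∞) = Module.length R
      (↥(a R Q i) ⧸ (a R Q (i + 1)).submoduleOf (a R Q i)) := by
    rw [Module.length_eq_of_surjective (R := ResidueField R) residue_surjective,
      Module.length_eq_finrank]
    rfl
  rw [h1]
  let e : a R Q i ≃ₗ[R] IsLocalization.coeSubmodule Q (a R Q i) :=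
    Submodule.equivMapOfInjective (Algebra.linearMap R Q) (IsFractionRing.injective R Q) _
  refine relLength_eq_length_of_surjective (Submodule.mkQ _ ∘ₗ e.symm.toLinearMap) (fun x => ?_)
    ((Submodule.mkQ_surjective _).comp e.symm.surjective)
  obtain ⟨x, rfl⟩ := e.surjective x
  rw [LinearMap.comp_apply, LinearEquiv.coe_coe, e.symm_apply_apply]
  exact (Submodule.Quotient.mk_eq_zero _).trans
    (mem_coeSubmodule (Q := Q) (I := a R Q (i + 1)) (x := x)).symm

variable [Module.Finite R (integralClosure R Q)]

theorem conductorIdeal_eq : conductorIdeal R Q = powClosure R Q (conductorExp R Q) :=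
  Nat.sInf_mem (s := {n : ℕ | conductorIdeal R Q = powClosure R Q n})
    (exists_conductorIdeal_eq_powClosure conductorIdeal_ne_bot)

theorem powClosure_conductorExp_le_one : powClosure R Q (conductorExp R Q) ≤ 1 :=
  conductorIdeal_eq.symm.le.trans conductorIdeal_le_one

theorem conductorExp_pos (hR : ¬ IsIntegrallyClosed R) : 0 < conductorExp R Q := by
  refine Nat.pos_of_ne_zero fun h => hR ?_
  have h1 := powClosure_conductorExp_le_one (R := R) (Q := Q)
  rw [h, powClosure_zero] at h1
  rw [isIntegrallyClosed_iff Q]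
  intro x hx
  exact Submodule.mem_one.1 (h1 hx)

theorem mem_values_of_conductorExp_le {m : ℕ} (h : conductorExp R Q ≤ m) : m ∈ values R Q := by
  obtain ⟨ϖ, hϖ⟩ := IsDiscreteValuationRing.exists_irreducible (integralClosure R Q)
  have h1 : ((ϖ ^ m : integralClosure R Q) : Q) ∈ (1 : Submodule R Q) := by
    refine powClosure_conductorExp_le_one (coe_mem_powClosure_iff.2 ?_)
    rw [hϖ.addVal_pow]
    exact_mod_cast h
  obtain ⟨x, hx⟩ := Submodule.mem_one.1 h1
  have hx' : algebraMap R (integralClosure R Q) x = ϖ ^ m := Subtype.ext hx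
  refine ⟨x, fun h0 => ?_, by rw [val, hx', hϖ.addVal_pow]⟩
  rw [h0, map_zero] at hx'
  exact pow_ne_zero m hϖ.ne_zero hx'.symm

/-- Every integer from `N` on is a value, so `v(R)` is infinite and `Nat.nth` never returns its
default value. -/
theorem s_strictMono : StrictMono (s R Q) :=
  Nat.nth_strictMono <| Set.infinite_of_not_bddAbove fun ⟨b, hb⟩ => by
    have := hb (mem_values_of_conductorExp_le (R := R) (Q := Q)
      (le_max_left (conductorExp R Q) (b + 1)))
    have := le_max_right (conductorExp R Q) (b + 1)
    omega

theorem s_seqLength : s R Q (seqLength R Q) = conductorExp R Q := by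
  classical
  exact Nat.sInf_mem (s := {i : ℕ | s R Q i = conductorExp R Q})
    ⟨_, Nat.nth_count (mem_values_of_conductorExp_le le_rfl)⟩

theorem seqLength_pos (hR : ¬ IsIntegrallyClosed R) : 0 < seqLength R Q := by
  refine Nat.pos_of_ne_zero fun h => (conductorExp_pos (Q := Q) hR).ne' ?_
  rw [← s_seqLength, h, s_zero]

theorem a_anti : Antitone (a R Q) := fun i j h x hx =>
  mem_a_iff.2 (le_trans (by exact_mod_cast s_strictMono.monotone h) (mem_a_iff.1 hx))

theorem coeSubmodule_a_seqLength :
    IsLocalization.coeSubmodule Q (a R Q (seqLength R Q)) = conductorIdeal R Q := by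
  rw [conductorIdeal_eq]
  refine le_antisymm ((coeSubmodule_a_le_powClosure _).trans_eq (by rw [s_seqLength])) ?_
  intro q hq
  obtain ⟨x, rfl⟩ := Submodule.mem_one.1 (powClosure_conductorExp_le_one hq)
  rw [mem_coeSubmodule, mem_a_iff, s_seqLength]
  exact algebraMap_mem_powClosure_iff.1 hq

theorem coeSubmodule_a_ne_bot (i : ℕ) : IsLocalization.coeSubmodule Q (a R Q i) ≠ ⊥ := by
  have h : IsLocalization.coeSubmodule Q (a R Q (i + seqLength R Q)) ≠ ⊥ := by
    obtain ⟨x, hx, hx'⟩ : s R Q (i + seqLength R Q) ∈ values R Q :=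
      mem_values_of_conductorExp_le <| by
        rw [← s_seqLength]
        exact s_strictMono.monotone (Nat.le_add_left _ _)
    refine (Submodule.ne_bot_iff _).2 ⟨algebraMap R Q x, mem_coeSubmodule.2 ?_, by simpa using hx⟩
    exact hx'.ge
  exact ne_bot_of_le_ne_bot h
    (IsLocalization.coeSubmodule_mono Q (a_anti (Nat.le_add_right i _)))

/-- Let `u` generate `C` over `R̄`. If `qC ⊆ R`, then `quR̄ ⊆ R`, so `qu ∈ C = uR̄` and `q ∈ R̄`. -/
theorem one_div_conductorIdeal : (1 : Submodule R Q) / conductorIdeal R Q = intClosure R Q := by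
  refine le_antisymm (fun q hq => ?_) fun q hq c hc => ?_
  · obtain ⟨ϖ, hϖ⟩ := IsDiscreteValuationRing.exists_irreducible (integralClosure R Q)
    let u : Q := (ϖ ^ conductorExp R Q : integralClosure R Q)
    have hu0 : u ≠ 0 := fun h => pow_ne_zero (conductorExp R Q) hϖ.ne_zero (Subtype.ext h)
    have hu : u ∈ conductorIdeal R Q := by
      rw [conductorIdeal_eq]
      exact coe_mem_powClosure_iff.2 (hϖ.addVal_pow _).ge
    have hqu : q * u ∈ conductorIdeal R Q := fun v hv => by
      rw [mul_assoc]
      exact hq _ (mul_mem_conductorIdeal hu hv)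
    rw [conductorIdeal_eq] at hqu
    obtain ⟨w, hw, hwq⟩ := mem_powClosure_iff.1 hqu
    rw [← hϖ.addVal_pow, IsDiscreteValuationRing.addVal_le_iff_dvd] at hw
    obtain ⟨z, rfl⟩ := hw
    have : q = z := mul_right_cancel₀ hu0 <| by
      rw [← hwq, mul_comm (z : Q)]
      rfl
    rw [this]
    exact z.2
  · rw [mul_comm]
    exact hc q hq

variable [IsLocalRing R]

theorem a_one : a R Q 1 = maximalIdeal R := by
  refine le_antisymm (le_maximalIdeal fun h => ?_) fun x hx => ?_
  · have h1 : (1 : R) ∈ a R Q 1 := h ▸ Submodule.mem_top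
    have h2 : s R Q 1 ≤ 0 := by
      have := mem_a_iff.1 h1
      simpa [val] using this
    have h3 : s R Q 0 < s R Q 1 := s_strictMono Nat.zero_lt_one
    omega
  · have h1 : (1 : R) ∈ a R Q 0 := a_zero (R := R) (Q := Q) ▸ Submodule.mem_top
    have h2 := @isTorsionBySet_quotient R Q _ _ _ _ _ _ _ 0 (Submodule.Quotient.mk ⟨1, h1⟩) ⟨x, hx⟩
    have h3 : x * 1 ∈ a R Q 1 := (Submodule.Quotient.mk_eq_zero
      ((a R Q (0 + 1)).submoduleOf (a R Q 0))).1 h2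
    rwa [mul_one] at h3

theorem t_one : t R Q 1 = cmType R Q := by
  unfold t cmType
  rw [a_one]
  congr 1
  rw [idealInv, Nat.sub_self, a_zero, IsLocalization.coeSubmodule_top]
  exact one_div_one

theorem n_zero [IsNoetherianRing R] : n R Q 0 = 1 := by
  have h : relLength R Q (IsLocalization.coeSubmodule Q (a R Q 0))
      (IsLocalization.coeSubmodule Q (a R Q (0 + 1))) = 1 := by
    have h1 : (1 : R) ∈ a R Q 0 := a_zero (R := R) (Q := Q) ▸ Submodule.mem_top
    refine length_eq_one_of_generator (a := (Submodule.Quotient.mk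
      ⟨algebraMap R Q 1, mem_coeSubmodule.2 h1⟩ : _ ⧸ Submodule.submoduleOf _ _)) ?_ ?_ ?_
    · intro h
      have h2 := mem_coeSubmodule.1 ((mk_submoduleOf_eq_zero _).1 h)
      rw [a_one] at h2
      exact (Ideal.IsMaximal.ne_top inferInstance) ((Ideal.eq_top_iff_one _).2 h2)
    · intro r hr
      refine (mk_submoduleOf_eq_zero _).2 ?_
      change r • algebraMap R Q 1 ∈ _
      rw [Algebra.smul_def, ← map_mul, mul_one, mem_coeSubmodule, a_one]
      exact hr
    · intro x
      obtain ⟨⟨_, ⟨x, hx, rfl⟩⟩, rfl⟩ := Submodule.Quotient.mk_surjective _ x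
      refine ⟨x, congrArg Submodule.Quotient.mk (Subtype.ext ?_)⟩
      change x • algebraMap R Q 1 = algebraMap R Q x
      rw [Algebra.smul_def, ← map_mul, mul_one]
  rw [relLength_coeSubmodule_a] at h
  exact_mod_cast h

end Values

/-! ### The leading-coefficient pairing and the inequality `nᵢ ≤ tᵢ₊₁`. -/

theorem length_le_of_ker_le {R B T P : Type*} [CommRing R] [AddCommGroup B] [Module R B]
    [AddCommGroup T] [Module R T] [AddCommGroup P] [Module R P] (f : B →ₗ[R] T) (g : B →ₗ[R] P)
    (hg : Function.Surjective g) (h : LinearMap.ker f ≤ LinearMap.ker g) :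
    Module.length R P ≤ Module.length R T := by
  refine le_trans ?_ (Module.length_le_of_injective (LinearMap.range f).subtype
    (Submodule.subtype_injective _))
  rw [← f.quotKerEquivRange.length_eq]
  refine Module.length_le_of_surjective ((LinearMap.ker f).liftQ g h) fun p => ?_
  obtain ⟨b, rfl⟩ := hg p
  exact ⟨Submodule.Quotient.mk b, rfl⟩

/-- The form `(x, y) ↦ φ(xy)` is nondegenerate since `K` is a field, and functionals on `A` extend
to `K`. -/
theorem surjective_dual_of_field {k K : Type*} [Field k] [Field K] [Algebra k K]
    [FiniteDimensional k K] {φ : K →ₗ[k] k} (hφ : φ ≠ 0) (A : Submodule k K) :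
    Function.Surjective (A.dualRestrict ∘ₗ (LinearMap.mul k K).compr₂ φ) := by
  refine Subspace.dualRestrict_surjective.comp ?_
  rw [← LinearMap.injective_iff_surjective_of_finrank_eq_finrank Subspace.dual_finrank_eq.symm,
    injective_iff_map_eq_zero]
  intro q hq
  by_contra hq0
  refine hφ (LinearMap.ext fun x => ?_)
  have h := LinearMap.congr_fun hq (q⁻¹ * x)
  simpa [mul_inv_cancel_left₀ hq0] using h

theorem exists_submodule_residueField {R M : Type*} [CommRing R] [IsLocalRing R]
    [AddCommGroup M] [Module R M] [Module (ResidueField R) M] [IsScalarTower R (ResidueField R) M] (U : Submodule R M) :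
    ∃ U' : Submodule (ResidueField R) M, ∀ x, x ∈ U' ↔ x ∈ U :=
  ⟨{ U with
      smul_mem' := fun c x hx => by
        obtain ⟨r, rfl⟩ := residue_surjective c
        rw [← ResidueField.algebraMap_eq, algebraMap_smul]
        exact U.smul_mem r hx }, fun _ => Iff.rfl⟩

section Pairing

variable {R Q : Type*} [CommRing R] [Field Q] [Algebra R Q]
  [IsDiscreteValuationRing (integralClosure R Q)]

/-- The maps `X ^ n R̄ → R̄/XR̄` taking the leading coefficient with respect to a fixed uniformizer;
they are surjective, with kernel `X ^ (n + 1) R̄`, and multiplicative. -/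
theorem exists_leadingCoeff : ∃ ρ : ∀ n : ℕ, powClosure R Q n →ₗ[R]
    ResidueField (integralClosure R Q),
    (∀ n, Function.Surjective (ρ n)) ∧
    (∀ n x, ρ n x = 0 ↔ (x : Q) ∈ powClosure R Q (n + 1)) ∧
    ∀ m n (x : powClosure R Q m) (y : powClosure R Q n),
      ρ (m + n) ⟨x * y, mul_mem_powClosure x.2 y.2⟩ = ρ m x * ρ n y := by
  obtain ⟨ϖ, hϖ⟩ := IsDiscreteValuationRing.exists_irreducible (integralClosure R Q)
  have hmul : ∀ n (v : integralClosure R Q),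
      ((ϖ ^ n * v : integralClosure R Q) : Q) ∈ powClosure R Q n := fun n v => by
    rw [coe_mem_powClosure_iff, ← hϖ.addVal_pow, IsDiscreteValuationRing.addVal_le_iff_dvd]
    exact dvd_mul_right _ _
  let e : ∀ n, integralClosure R Q ≃ₗ[R] powClosure R Q n := fun n =>
    LinearEquiv.ofBijective
      (LinearMap.codRestrict (powClosure R Q n)
        ((integralClosure R Q).val.toLinearMap ∘ₗ LinearMap.mulLeft R (ϖ ^ n)) (hmul n)) <| by
      constructor
      · intro v w h
        exact mul_left_cancel₀ (pow_ne_zero n hϖ.ne_zero)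
          (Subtype.ext (congrArg (fun x : powClosure R Q n => (x : Q)) h))
      · rintro ⟨q, hq⟩
        obtain ⟨v, hv, rfl⟩ := mem_powClosure_iff.1 hq
        rw [← hϖ.addVal_pow, IsDiscreteValuationRing.addVal_le_iff_dvd] at hv
        obtain ⟨w, rfl⟩ := hv
        exact ⟨w, rfl⟩
  have he : ∀ n v, ((e n v : powClosure R Q n) : Q) = (ϖ ^ n * v : integralClosure R Q) :=
    fun _ _ => rfl
  let res : integralClosure R Q →ₗ[R] ResidueField (integralClosure R Q) :=
    (IsScalarTower.toAlgHom R (integralClosure R Q)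
      (ResidueField (integralClosure R Q))).toLinearMap
  have hres : ∀ v, res v = residue _ v := fun _ => rfl
  refine ⟨fun n => res ∘ₗ (e n).symm.toLinearMap, fun n => ?_, fun n x => ?_, fun m n x y => ?_⟩
  · exact (residue_surjective (R := integralClosure R Q)).comp (e n).symm.surjective
  · obtain ⟨v, rfl⟩ := (e n).surjective x
    rw [LinearMap.comp_apply, LinearEquiv.coe_coe, LinearEquiv.symm_apply_apply, hres,
      residue_eq_zero_iff, he, coe_mem_powClosure_iff, hϖ.maximalIdeal_eq,
      Ideal.mem_span_singleton, ← hϖ.addVal_pow, IsDiscreteValuationRing.addVal_le_iff_dvd,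
      pow_succ, mul_dvd_mul_iff_left (pow_ne_zero n hϖ.ne_zero)]
  · obtain ⟨v, rfl⟩ := (e m).surjective x
    obtain ⟨w, rfl⟩ := (e n).surjective y
    have h : (⟨(e m v : Q) * (e n w : Q), mul_mem_powClosure (e m v).2 (e n w).2⟩ :
        powClosure R Q (m + n)) = e (m + n) (v * w) := by
      refine Subtype.ext ?_
      change ((ϖ ^ m * v : integralClosure R Q) : Q) * ((ϖ ^ n * w : integralClosure R Q) : Q) =
        ((ϖ ^ (m + n) * (v * w) : integralClosure R Q) : Q)
      rw [← Subalgebra.coe_mul]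
      congr 1
      ring
    simp only [LinearMap.comp_apply, LinearEquiv.coe_coe, h, LinearEquiv.symm_apply_apply, hres,
      map_mul]

variable [IsDomain R] [IsFractionRing R Q] [Module.Finite R (integralClosure R Q)]

instance : FaithfulSMul R (integralClosure R Q) := by
  rw [faithfulSMul_iff_algebraMap_injective]
  intro x y h
  apply IsFractionRing.injective R Q
  simpa using congrArg (algebraMap (integralClosure R Q) Q) h

/-- An `R̄`-submodule of `Q` contained in `R` lies in `C = X ^ N R̄`. -/
theorem not_powClosure_le_one (hR : ¬ IsIntegrallyClosed R) :
    ¬ powClosure R Q (conductorExp R Q - 1) ≤ 1 := by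
  intro h
  have hN := conductorExp_pos (Q := Q) hR
  have h1 : powClosure R Q (conductorExp R Q - 1) ≤ powClosure R Q (conductorExp R Q) := by
    rw [← conductorIdeal_eq]
    exact fun x hx y hy => h (mul_mem_powClosure_of_mem_intClosure hx hy)
  obtain ⟨ϖ, hϖ⟩ := IsDiscreteValuationRing.exists_irreducible (integralClosure R Q)
  have h2 := h1 (coe_mem_powClosure_iff.2 (hϖ.addVal_pow (conductorExp R Q - 1)).ge)
  rw [coe_mem_powClosure_iff, hϖ.addVal_pow] at h2
  have h3 : conductorExp R Q ≤ conductorExp R Q - 1 := by exact_mod_cast h2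
  omega

/-- Let `K` be the residue field of `R̄`, `A ⊆ K` the leading coefficients of `𝔞ᵢ` (so `dim A =
nᵢ`), and `φ` a nonzero functional on `K` vanishing on those of `R ∩ X ^ (N - 1) R̄`. With `j + sᵢ =
N - 1`, the form `φ(xy)` gives a surjection from `X ^ j R̄` to the dual of `A`. It kills `X ^ j R̄ ∩
𝔞ᵢ⁻¹`, while `X ^ j R̄ ⊆ 𝔞ᵢ₊₁⁻¹`. -/
theorem n_le_t [IsLocalRing R] [IsNoetherianRing R] (hR : ¬ IsIntegrallyClosed R) {i : ℕ}
    (hi : i < seqLength R Q) : (n R Q i : ℕ∞) ≤ t R Q (i + 1) := by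
  have hs : s R Q i < conductorExp R Q := by
    rw [← s_seqLength]
    exact s_strictMono hi
  obtain ⟨j, hj⟩ : ∃ j, j + s R Q i = conductorExp R Q - 1 :=
    ⟨conductorExp R Q - 1 - s R Q i, by omega⟩
  have hN : conductorExp R Q = j + s R Q i + 1 := by omega
  obtain ⟨ρ, hsurj, hker, hmul⟩ := exists_leadingCoeff (R := R) (Q := Q)
  obtain ⟨U, hU⟩ := exists_submodule_residueField
    (((1 : Submodule R Q).submoduleOf (powClosure R Q (j + s R Q i))).map (ρ (j + s R Q i)))
  -- If `R` attained all leading coefficients in degree `N - 1`, then `X ^ N R̄ ⊆ R` would force `X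
  -- ^ (N - 1) R̄ ⊆ R`.
  have hUtop : U ≠ ⊤ := by
    intro h
    refine not_powClosure_le_one (Q := Q) hR fun x hx => ?_
    rw [← hj] at hx
    have h1 : ρ _ ⟨x, hx⟩ ∈ U := h ▸ Submodule.mem_top
    obtain ⟨y, hy, hyx⟩ := (hU _).1 h1
    rw [← sub_eq_zero, ← map_sub, hker, ← hN] at hyx
    have h2 := sub_mem (show (y : Q) ∈ (1 : Submodule R Q) from hy)
      (powClosure_conductorExp_le_one hyx)
    simpa using h2
  obtain ⟨φ, hφ, hUφ⟩ := Submodule.exists_le_ker_of_lt_top U hUtop.lt_top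
  let α := ρ (s R Q i) ∘ₗ Submodule.inclusion (coeSubmodule_a_le_powClosure (R := R) (Q := Q) i)
  have hα : ∀ x, α x = 0 ↔ (x : Q) ∈ IsLocalization.coeSubmodule Q (a R Q (i + 1)) := by
    rintro ⟨_, ⟨x, hx, rfl⟩⟩
    refine (hker _ _).trans ?_
    change algebraMap R Q x ∈ _ ↔ algebraMap R Q x ∈ _
    rw [algebraMap_mem_powClosure_iff, mem_coeSubmodule, mem_a_iff]
    refine ⟨s_succ_le_val, fun h => le_trans ?_ h⟩
    exact_mod_cast s_strictMono (Nat.lt_succ_self i)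
  obtain ⟨A, hA⟩ := exists_submodule_residueField (LinearMap.range α)
  have hnA : (n R Q i : ℕ∞) = Module.length R (Module.Dual (ResidueField R) A) := by
    rw [← relLength_coeSubmodule_a, relLength_eq_length_range α hα,
      Module.length_eq_of_surjective (R := ResidueField R) (M := Module.Dual (ResidueField R) A)
        residue_surjective, Module.length_eq_finrank, Subspace.dual_finrank_eq,
      ← Module.length_eq_finrank,
      ← Module.length_eq_of_surjective (S := R) (R := ResidueField R) (M := A) residue_surjective]
    have : LinearMap.range α = A.restrictScalars R := by
      ext x
      exact (hA x).symm
    rw [this]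
    rfl
  rw [hnA]
  let Ψ := A.dualRestrict ∘ₗ (LinearMap.mul _ _).compr₂ φ
  -- Products have value at least `j + sᵢ₊₁ ≥ j + sᵢ + 1 = N`, so they lie in `C ⊆ R`.
  have hB : powClosure R Q j ≤ idealInv R Q (a R Q (i + 1)) := by
    intro x hx y hy
    refine powClosure_conductorExp_le_one ?_
    rw [hN, add_assoc]
    refine mul_mem_powClosure hx (powClosure_anti ?_ (coeSubmodule_a_le_powClosure _ hy))
    exact s_strictMono (Nat.lt_succ_self i)
  refine length_le_of_ker_le (B := powClosure R Q j) (Submodule.mkQ _ ∘ₗ Submodule.inclusion hB)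
    (Ψ.restrictScalars R ∘ₗ ρ j) ((surjective_dual_of_field hφ A).comp (hsurj j)) ?_
  intro x hx
  have hx' : (x : Q) ∈ idealInv R Q (a R Q i) := (Submodule.Quotient.mk_eq_zero
    ((idealInv R Q (a R Q i)).submoduleOf (idealInv R Q (a R Q (i + 1))))).1 hx
  rw [LinearMap.mem_ker]
  ext ⟨z, hz⟩
  obtain ⟨y, rfl⟩ := (hA z).1 hz
  change φ (ρ j x * ρ (s R Q i) ⟨y, _⟩) = 0
  rw [← hmul]
  exact hUφ ((hU _).2 ⟨_, hx' y y.2, rfl⟩)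

end Pairing

/-! ### Summation along the filtration and comparison of the two sequences. -/

section Main

variable {R Q : Type*} [CommRing R] [Field Q] [Algebra R Q]

theorem sum_relLength_of_antitone {E : ℕ → Submodule R Q} (hE : Antitone E) (m : ℕ) :
    ∑ i ∈ Finset.range m, relLength R Q (E i) (E (i + 1)) = relLength R Q (E 0) (E m) := by
  induction m with
  | zero => simp [relLength_self]
  | succ m ih =>
    rw [Finset.sum_range_succ, ih, add_comm,
      ← relLength_add (hE (Nat.le_succ m)) (hE (Nat.zero_le m))]

theorem sum_relLength_of_monotone {E : ℕ → Submodule R Q} (hE : Monotone E) (m : ℕ) :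
    ∑ i ∈ Finset.range m, relLength R Q (E (i + 1)) (E i) = relLength R Q (E m) (E 0) := by
  induction m with
  | zero => simp [relLength_self]
  | succ m ih =>
    rw [Finset.sum_range_succ, ih, ← relLength_add (hE (Nat.zero_le m)) (hE (Nat.le_succ m))]

theorem map_range_succ_eq_cons_iff {α : Type*} (f g : ℕ → α) (c : α) (m : ℕ) :
    (List.range (m + 1)).map f = c :: (List.range m).map g ↔
      f 0 = c ∧ ∀ j < m, f (j + 1) = g j := by
  rw [List.range_succ_eq_map, List.map_cons, List.cons.injEq, List.map_map, List.map_inj_left]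
  simp only [List.mem_range, Function.comp_apply]

variable [IsDiscreteValuationRing (integralClosure R Q)] [IsDomain R]

theorem coeSubmodule_a_zero : IsLocalization.coeSubmodule Q (a R Q 0) = 1 := by
  rw [a_zero, IsLocalization.coeSubmodule_top]

variable [IsFractionRing R Q] [Module.Finite R (integralClosure R Q)]

theorem sum_t : ∑ i ∈ Finset.range (seqLength R Q), t R Q (i + 1) =
    relLength R Q (intClosure R Q) 1 := by
  refine (sum_relLength_of_monotone (E := fun i => idealInv R Q (a R Q i)) (fun i j h =>
    one_div_anti (IsLocalization.coeSubmodule_mono Q (a_anti h))) _).trans ?_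
  simp only [idealInv, coeSubmodule_a_zero, coeSubmodule_a_seqLength, one_div_conductorIdeal,
    one_div_one]

variable [IsLocalRing R]

theorem typeSequence_eq_cons_iff (hR : ¬ IsIntegrallyClosed R) (c : ℕ∞) :
    typeSequence R Q =
        c :: (List.range (seqLength R Q - 1)).map (fun j => (n R Q (j + 1) : ℕ∞)) ↔
      cmType R Q = c ∧ ∀ j < seqLength R Q - 1, t R Q (j + 2) = n R Q (j + 1) := by
  -- `R ≠ R̄` makes the sequence nonempty, so it has a head and `seqLength R Q - 1` is not
  -- truncated.
  obtain ⟨m, hm⟩ := Nat.exists_eq_succ_of_ne_zero (seqLength_pos (Q := Q) hR).ne'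
  rw [typeSequence, hm, Nat.succ_eq_add_one, Nat.add_sub_cancel, map_range_succ_eq_cons_iff,
    zero_add, t_one]

variable [IsNoetherianRing R]

theorem sum_n : ∑ i ∈ Finset.range (seqLength R Q), (n R Q i : ℕ∞) =
    relLength R Q 1 (conductorIdeal R Q) := by
  simp only [← relLength_coeSubmodule_a]
  refine (sum_relLength_of_antitone (E := fun i => IsLocalization.coeSubmodule Q (a R Q i))
    (fun i j h => IsLocalization.coeSubmodule_mono Q (a_anti h)) _).trans ?_
  rw [coeSubmodule_a_zero, coeSubmodule_a_seqLength]

theorem t_eq_n_of_cmType_eq_one (hdim : ringKrullDim R = 1) (h : cmType R Q = 1) (i : ℕ) :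
    t R Q (i + 1) = n R Q i := by
  have hle : IsLocalization.coeSubmodule Q (a R Q i) ≤ 1 :=
    coeSubmodule_a_zero (R := R) (Q := Q) ▸
      IsLocalization.coeSubmodule_mono Q (a_anti (Nat.zero_le i))
  have key := relLength_one_div_eq_of_baer hdim (baer_of_cmType_eq_one hdim h)
    (coeSubmodule_a_ne_bot (R := R) (Q := Q) (i + 1))
    (IsLocalization.coeSubmodule_mono Q (a_anti (Nat.le_succ i))) hle
  rw [h, one_mul, relLength_coeSubmodule_a] at key
  exact key

/-- All lengths are finite, so the defining equation becomes one between natural numbers. Removing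
`t₁` and `n₀ = 1` leaves two sums, one bounded by the other term by term; they agree iff all their
terms do. -/
theorem isAlmostGorenstein_iff (hdim : ringKrullDim R = 1) (hR : ¬ IsIntegrallyClosed R) :
    IsAlmostGorenstein R Q ↔ ∀ j < seqLength R Q - 1, t R Q (j + 2) = n R Q (j + 1) := by
  obtain ⟨m, hm⟩ := Nat.exists_eq_succ_of_ne_zero (seqLength_pos (Q := Q) hR).ne'
  have hV : IsNoetherian R (intClosure R Q) :=
    inferInstanceAs (IsNoetherian R (integralClosure R Q))
  have hfin : relLength R Q (intClosure R Q) 1 ≠ ⊤ :=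
    relLength_ne_top hdim one_ne_zero one_le_intClosure
  have hT := sum_t (R := R) (Q := Q)
  have hN := sum_n (R := R) (Q := Q)
  rw [← hT] at hfin
  have htop : ∀ i < m + 1, t R Q (i + 1) ≠ ⊤ := fun i hi => by
    refine ne_top_of_le_ne_top hfin
      (Finset.single_le_sum (f := fun i => t R Q (i + 1)) (fun _ _ => zero_le) ?_)
    rwa [Finset.mem_range, hm]
  choose! T hTt using fun i hi => ENat.ne_top_iff_exists.1 (htop i hi)
  have hle : ∀ i < m + 1, n R Q i ≤ T i := fun i hi => by
    have := n_le_t (Q := Q) hR (i := i) (by rwa [hm])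
    rw [← hTt i hi] at this
    exact_mod_cast this
  have hsum : ∑ i ∈ Finset.range (m + 1), t R Q (i + 1) =
      ((∑ i ∈ Finset.range (m + 1), T i : ℕ) : ℕ∞) := by
    rw [Nat.cast_sum]
    exact Finset.sum_congr rfl fun i hi => (hTt i (Finset.mem_range.1 hi)).symm
  unfold IsAlmostGorenstein
  rw [← hT, ← hN, ← t_one, hm, Nat.succ_eq_add_one, hsum, ← hTt 0 (Nat.succ_pos m),
    Nat.add_sub_cancel, ← Nat.cast_sum, Finset.sum_range_succ', Finset.sum_range_succ', n_zero]
  have h1 : (((∑ i ∈ Finset.range m, T (i + 1) + T 0 : ℕ) : ℕ∞) + 1 =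
      ((∑ i ∈ Finset.range m, n R Q (i + 1) + 1 : ℕ) : ℕ∞) + (T 0 : ℕ∞)) ↔
      ∑ i ∈ Finset.range m, n R Q (i + 1) = ∑ i ∈ Finset.range m, T (i + 1) := by
    norm_cast
    omega
  rw [h1, Finset.sum_eq_sum_iff_of_le fun i hi => hle _ (by simpa using hi)]
  refine ⟨fun h j hj => ?_, fun h j hj => ?_⟩
  · rw [← hTt (j + 1) (by omega), h j (Finset.mem_range.2 hj)]
  · have hj' := Finset.mem_range.1 hj
    have := h j hj'
    rw [← hTt (j + 1) (by omega)] at this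
    exact_mod_cast this.symm

end Main

end TypeSeq

theorem mainTheorem3 (R Q : Type*) [CommRing R] [IsDomain R] [IsLocalRing R] [IsNoetherianRing R]
    [Field Q] [Algebra R Q] [IsFractionRing R Q]
    (hdim : ringKrullDim R = 1)
    [IsDiscreteValuationRing (integralClosure R Q)]
    [Module.Finite R (integralClosure R Q)]
    (hR : ¬ IsIntegrallyClosed R) :
    (TypeSeq.IsGorenstein R ↔
      TypeSeq.typeSequence R Q =
        1 :: (List.range (TypeSeq.seqLength R Q - 1)).map fun j => (TypeSeq.n R Q (j + 1) : ℕ∞)) ∧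
    (TypeSeq.IsKunz R Q ↔
      TypeSeq.typeSequence R Q =
        2 :: (List.range (TypeSeq.seqLength R Q - 1)).map fun j => (TypeSeq.n R Q (j + 1) : ℕ∞)) := by
  rw [TypeSeq.typeSequence_eq_cons_iff hR, TypeSeq.typeSequence_eq_cons_iff hR,
    TypeSeq.isGorenstein_iff_baer Q hdim, TypeSeq.baer_iff_cmType_eq_one hdim, TypeSeq.IsKunz,
    TypeSeq.isAlmostGorenstein_iff hdim hR]
  -- In the Gorenstein case the first entry alone decides, since type one already forces the
  -- remaining equalities.
  exact ⟨⟨fun h => ⟨h, fun j _ => TypeSeq.t_eq_n_of_cmType_eq_one hdim h (j + 1)⟩, And.left⟩,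
    and_comm⟩
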